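/- **Setting.** There are $n$ agents on an interaction graph; $\mathcal N_i$ is the neighbourhood of agent $i$, including $i$. Agent $i$ has states $s_i\in\mathcal S_i\subseteq\mathbb R^{d_i^s}$ with $d^s_i\le m$, actions $a_i\in\mathcal A_i\subseteq\mathbb R^{d_i^a}$ ($\mathcal S_i$, $\mathcal A_i$ Borel), and a domain factor $\omega_i\in\Omega_i\subset\mathbb R^{d_i}$ (Euclidean norm), $\Omega_i$ compact. In the domain $\omega=(\omega_i)_i\in\Omega=\prod_i\Omega_i$ the states evolve by $$s_{i,j}(t+1)=f_{i,j}\big(c^{s}_{i,j}\odot s_{\mathcal N_i}(t),\,c^{a}_{i,j}\odot a_i(t),\,c^{\omega}_{i,j}\odot\omega_i,\,\varepsilon_{i,j}(t)\big),$$ with binary causal masks $c$. The noise variables $\varepsilon_{i,j}(t)$ are independent over $i,j$; the noise $\varepsilon(t)$ of time $t$ is independent of all states and actions up to time $t$; the law of $\varepsilon_{i,j}(t)$ does not depend on $t$. Actions may be random and may depend on the past in any way. Let $P_i(\cdot\mid s_{\mathcal N_i},a_i,\omega_i)$ be the law of $s_i(t+1)$ given $s_{\mathcal N_i}(t)$ and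 $a_i(t)$. **Assumptions.** Fix $m\in\mathbb N$, $\sigma,L,V,K\ge 0$ and $\kappa,\alpha>0$. 1. The causal masks are known, i.e. the estimated masks equal $c$. 2. (Noise) Each $\varepsilon_{i,j}$ is sub-Gaussian with parameter $\sigma^2$ (that is, $\mathbb E e^{u\varepsilon_{i,j}}\le e^{\sigma^2u^2/2}$ for all $u$), and has a density $q_{i,j}$ of total variation at most $V$ on $\mathbb R$. 3. (Dynamics) For states in the $\mathcal S_k$, actions in $\mathcal A_i$ and factors in $\Omega_i$: $f_{i,j}$, composed with the masks, is measurable in state, action and noise, is $L$-Lipschitz in $\omega_i$, and is differentiable in the noise with derivative at least $\kappa$, and this derivative is $K$-Lipschitz in $(\omega_i,\varepsilon)$, i.e. changes by at most $K(\|\omega_i-\omega_i'\|_2+|\varepsilon-\varepsilon'|)$. (For additive noise the derivative is $1$.) 4. (Separation) For all $r>0$, all $i$, all states and actions in the sets above, and all $\omega_i,\omega_i'\in\Omega_i$ with $\|\omega_i-\omega_i'\|_2\ge r$, $$\|P_i(\cdot\mid s_{\mathcal N_i},a_i,\omega_i)-P_i(\cdot\mid s_{\mathcal N_i},a_i,\omega_i')\|_{\mathrm{TV}}\ge\alpha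 r,\qquad \|\mu-\nu\|_{\rm TV}=\sup_A|\mu(A)-\nu(A)|.$$ **Estimator.** Let $p_i(y\mid s_{\mathcal N_i},a_i,\omega_i)=\prod_j q_{i,j}(e_j)/\partial_\varepsilon f_{i,j}(\dots,e_j)$, where $e_j$ is the noise value that produces $y_j$, be the density of $P_i$, and let $$\mathcal L_i(\omega_i)=-\frac1{T_e}\sum_{t=0}^{T_e-1}\log p_i\big(s_i(t+1)\mid s_{\mathcal N_i}(t),a_i(t),\omega_i\big)\in(-\infty,+\infty].$$ A maximum-likelihood estimator is a random vector $\hat\omega$ that almost surely minimises $\frac1n\sum_i\mathcal L_i(\omega_i)$ over $\omega\in\Omega$. **Claim.** There is a constant $C_\omega>0$ that depends only on $(L,\sigma,\alpha,V,\kappa,K,m)$, and for all $d\in\mathbb N$ and $D_\Omega\in\mathbb R$ a constant $C'_\omega>0$ that depends only on these quantities and on $d$ and $D_\Omega$, such that the following holds for all systems as above with $d_i\le d$ and $\operatorname{diam}\Omega_i\le D_\Omega$ for all $i$, all true factors $\omega^*\in\Omega$, all $T_e$ with $nT_e\ge2$, all $\delta\in(0,1)$, all trajectories of length $T_e$ of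 the domain $\omega^*$ whose states and actions at times $t<T_e$ almost surely lie in the sets $\mathcal S_i$, $\mathcal A_i$, and all maximum-likelihood estimators $\hat\omega$. With probability at least $1-\delta$, all of the following hold simultaneously: $$\|\hat\omega_i-\omega_i^*\|_2\le C_\omega\sqrt{\frac{d_i\log(nT_e/\delta)}{T_e}}\ \text{ for all } i,\qquad \|\hat\omega-\omega^*\|_2\le C_\omega\sqrt{\frac{\dim(\Omega)\log(nT_e/\delta)}{T_e}},\quad \dim(\Omega):=\sum_i d_i,$$ $$\|\hat\omega_i-\omega_i^*\|_2\le C'_\omega\sqrt{\frac{D_\Omega\log(nT_e/\delta)}{T_e}}\ \text{ for all } i,\qquad \|\hat\omega-\omega^*\|_2\le C'_\omega\sqrt{\frac{n\,D_\Omega\log(nT_e/\delta)}{T_e}}.$$ -/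

import Mathlib

open MeasureTheory ProbabilityTheory
open scoped NNReal ENNReal

noncomputable section

namespace NetworkedMARL

/-- The interaction graph on `n` agents, with the dimensions of the local states, the local actions
and the local domain factors. -/
structure Network (n : ℕ) where
  graph : SimpleGraph (Fin n)
  stateDim : Fin n → ℕ
  actionDim : Fin n → ℕ
  factorDim : Fin n → ℕ

namespace Network

variable {n : ℕ} (N : Network n)

/-- The neighbourhood of agent `i`, which contains `i` itself. -/
abbrev Nbr (i : Fin n) : Type := {k : Fin n // k = i ∨ N.graph.Adj i k}

/-- Local states `s_i`. -/
abbrev LocalState (i : Fin n) : Type := Fin (N.stateDim i) → ℝ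

/-- Local actions `a_i`. -/
abbrev LocalAction (i : Fin n) : Type := Fin (N.actionDim i) → ℝ

/-- Local domain factors `ω_i`, with the Euclidean norm. -/
abbrev LocalFactor (i : Fin n) : Type := EuclideanSpace ℝ (Fin (N.factorDim i))

/-- Global states `s = (s_i)`. -/
abbrev State : Type := ∀ i, N.LocalState i

/-- Joint actions `a = (a_i)`. -/
abbrev Action : Type := ∀ i, N.LocalAction i

/-- Domain factors `ω = (ω_i)`. -/
abbrev Factor : Type := ∀ i, N.LocalFactor i

/-- States of the agents in the neighbourhood of `i`. -/
abbrev NbrState (i : Fin n) : Type := ∀ k : N.Nbr i, N.LocalState k.1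

/-- The noise variables `ε_{i,j}` of one time step. -/
abbrev Noise : Type := ∀ i, Fin (N.stateDim i) → ℝ

/-- Restriction of a global state to the neighbourhood of `i`. -/
def restrict (i : Fin n) (s : N.State) : N.NbrState i := fun k => s k.1

end Network

/-- The binary causal masks of the state components: the mask of the neighbouring states, of the
own action, and of the own domain factor. -/
structure Masks {n : ℕ} (N : Network n) where
  state : ∀ i, Fin (N.stateDim i) → ∀ k : N.Nbr i, Fin (N.stateDim k.1) → Bool
  action : ∀ i, Fin (N.stateDim i) → Fin (N.actionDim i) → Bool
  factor : ∀ i, Fin (N.stateDim i) → Fin (N.factorDim i) → Bool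

/-- Element-wise product `c ⊙ x` of a binary mask and a real vector. -/
def mask {ι : Type*} (c : ι → Bool) (x : ι → ℝ) : ι → ℝ := fun l => if c l then x l else 0

/-- The part of the model that all domains share, apart from the causal masks: the transition
functions `f_{i,j}`, the densities of the noise variables `ε_{i,j}`, and the local state, action and
domain factor spaces. -/
structure Model {n : ℕ} (N : Network n) where
  f : ∀ i, Fin (N.stateDim i) → N.NbrState i → N.LocalAction i →
    (Fin (N.factorDim i) → ℝ) → ℝ → ℝ
  noiseDensity : ∀ i, Fin (N.stateDim i) → ℝ → ℝ≥0
  stateSpace : ∀ i, Set (N.LocalState i)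
  actionSpace : ∀ i, Set (N.LocalAction i)
  factorSpace : ∀ i, Set (N.LocalFactor i)

/-- Total variation distance `sup_A |μ(A) - ν(A)|`. -/
def tvDist {α : Type*} [MeasurableSpace α] (μ ν : Measure α) : ℝ :=
  ⨆ A : {A : Set α // MeasurableSet A}, |μ.real A.1 - ν.real A.1|

namespace Model

variable {n : ℕ} {N : Network n} (M : Model N) (c : Masks N)

/-- The law of the noise variable `ε_{i,j}`. -/
def noiseLaw (i : Fin n) (j : Fin (N.stateDim i)) : Measure ℝ :=
  volume.withDensity fun e => (M.noiseDensity i j e : ℝ≥0∞)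

/-- The masked transition map: the next value of `s_{i,j}` is
`f_{i,j}(c ⊙ s_{N_i}, c ⊙ a_i, c ⊙ ω_i, e)`. -/
def step (i : Fin n) (j : Fin (N.stateDim i)) (s : N.NbrState i) (a : N.LocalAction i)
    (w : N.LocalFactor i) (e : ℝ) : ℝ :=
  M.f i j (fun k => mask (c.state i j k) (s k)) (mask (c.action i j) a)
    (mask (c.factor i j) fun l => w l) e

/-- The transition law `P(s_i(t+1) | s_{N_i}(t) = s, a_i(t) = a, ω_i = w)`, the components of the
noise being independent. -/
def transitionLaw (i : Fin n) (s : N.NbrState i) (a : N.LocalAction i) (w : N.LocalFactor i) :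
    Measure (N.LocalState i) :=
  (Measure.pi (M.noiseLaw i)).map fun e j => M.step c i j s a w (e j)

/-- The value of the noise variable `ε_{i,j}` that leads to the next value `y` of `s_{i,j}`
(`e ↦ step e` is a bijection of `ℝ` under the standing hypotheses below). -/
def noiseOf (i : Fin n) (j : Fin (N.stateDim i)) (s : N.NbrState i) (a : N.LocalAction i)
    (w : N.LocalFactor i) (y : ℝ) : ℝ :=
  Function.invFun (M.step c i j s a w) y

/-- The density of the transition law at `y`, by change of variables: the product over the
components `j` of `q_{i,j}(e_j) / ∂_e f_{i,j}(…, e_j)`, where `e_j` is the noise that leads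
to `y_j`. -/
def transitionDensity (i : Fin n) (s : N.NbrState i) (a : N.LocalAction i) (w : N.LocalFactor i)
    (y : N.LocalState i) : ℝ≥0∞ :=
  ∏ j, (M.noiseDensity i j (M.noiseOf c i j s a w (y j)) : ℝ≥0∞) /
    ENNReal.ofReal (deriv (M.step c i j s a w) (M.noiseOf c i j s a w (y j)))

/-- The negative log-likelihood `L_i` of agent `i` on the first `T` transitions of a trajectory, with
value `+∞` where the likelihood vanishes. -/
def negLogLik (T : ℕ) (s : ℕ → N.State) (a : ℕ → N.Action) (i : Fin n) (w : N.LocalFactor i) :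
    EReal :=
  -((∑ t ∈ Finset.range T,
    ENNReal.log (M.transitionDensity c i (N.restrict i (s t)) (a t i) w (s (t + 1) i))) / (T : EReal))

/-- The average over the agents of their negative log-likelihoods. -/
def avgNegLogLik (T : ℕ) (s : ℕ → N.State) (a : ℕ → N.Action) (w : N.Factor) : EReal :=
  (∑ i, M.negLogLik c T s a i (w i)) / (n : EReal)

/-- `w` is a maximum-likelihood estimate: it minimises the average negative log-likelihood
over the domain factor space `Ω = ∏ Ω_i`. -/
def IsMLE (T : ℕ) (s : ℕ → N.State) (a : ℕ → N.Action) (w : N.Factor) : Prop :=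
  (∀ i, w i ∈ M.factorSpace i) ∧
    ∀ w' : N.Factor, (∀ i, w' i ∈ M.factorSpace i) →
      M.avgNegLogLik c T s a w ≤ M.avgNegLogLik c T s a w'

/-- Sub-Gaussian noise with parameter `σ²`, with a density of total variation at most `V`. -/
structure NoiseRegular (σ : ℝ≥0) (V : ℝ) : Prop where
  isProb : ∀ i j, IsProbabilityMeasure (M.noiseLaw i j)
  subGaussian : ∀ i j, HasSubgaussianMGF (fun e : ℝ => e) (σ ^ 2) (M.noiseLaw i j)
  variation_le : ∀ i j, eVariationOn (M.noiseDensity i j) Set.univ ≤ ENNReal.ofReal V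

/-- The transition functions are `L`-Lipschitz in the domain factor and increasing in the noise, and
their derivative with respect to the noise is at least `κ` and is `K`-Lipschitz in
the domain factor and the noise. Additive noise is the case in which this derivative is `1`. -/
structure DynamicsRegular (L κ K : ℝ) : Prop where
  measurable_step : ∀ i j, ∀ w ∈ M.factorSpace i,
    Measurable fun p : N.NbrState i × N.LocalAction i × ℝ => M.step c i j p.1 p.2.1 w p.2.2
  lipschitz_factor : ∀ i j, ∀ s : N.NbrState i, (∀ k, s k ∈ M.stateSpace k.1) →
    ∀ a ∈ M.actionSpace i, ∀ w ∈ M.factorSpace i, ∀ w' ∈ M.factorSpace i, ∀ e : ℝ,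
      |M.step c i j s a w e - M.step c i j s a w' e| ≤ L * ‖w - w'‖
  le_deriv : ∀ i j, ∀ s : N.NbrState i, (∀ k, s k ∈ M.stateSpace k.1) →
    ∀ a ∈ M.actionSpace i, ∀ w ∈ M.factorSpace i, ∀ e : ℝ,
      κ ≤ deriv (M.step c i j s a w) e
  lipschitz_deriv : ∀ i j, ∀ s : N.NbrState i, (∀ k, s k ∈ M.stateSpace k.1) →
    ∀ a ∈ M.actionSpace i, ∀ w ∈ M.factorSpace i, ∀ w' ∈ M.factorSpace i, ∀ e e' : ℝ,
      |deriv (M.step c i j s a w) e - deriv (M.step c i j s a w') e'| ≤ K * (‖w - w'‖ + |e - e'|)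

/-- Total-variation separation of the domain factors: factors at distance at least `r` induce
transition laws at total variation distance at least `α r`, at all states and actions. -/
def Separated (α : ℝ) : Prop :=
  ∀ i, ∀ s : N.NbrState i, (∀ k, s k ∈ M.stateSpace k.1) → ∀ a ∈ M.actionSpace i,
    ∀ w ∈ M.factorSpace i, ∀ w' ∈ M.factorSpace i, ∀ r : ℝ, 0 < r → r ≤ ‖w - w'‖ →
      α * r ≤ tvDist (M.transitionLaw c i s a w) (M.transitionLaw c i s a w')

/-- `(s(t), a(t))` is a trajectory of length `T` of the domain `w`, driven by the noise `ε(t)`: the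
noise variables `ε_{i,j}(t)` are independent over `i, j`, and `ε(t)` is independent of the states
and actions up to time `t`. The actions may be random and depend on the past in any way. -/
structure IsTrajectory {X : Type*} [MeasurableSpace X] (P : Measure X) (T : ℕ) (w : N.Factor)
    (s : ℕ → X → N.State) (a : ℕ → X → N.Action) (ε : ℕ → X → N.Noise) : Prop where
  measurable_state : ∀ t, Measurable (s t)
  measurable_action : ∀ t, Measurable (a t)
  measurable_noise : ∀ t, Measurable (ε t)
  state_mem : ∀ t < T, ∀ᵐ x ∂P, ∀ i, s t x i ∈ M.stateSpace i
  action_mem : ∀ t < T, ∀ᵐ x ∂P, ∀ i, a t x i ∈ M.actionSpace i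
  transition : ∀ t < T, ∀ᵐ x ∂P, ∀ i j,
    s (t + 1) x i j = M.step c i j (N.restrict i (s t x)) (a t x i) (w i) (ε t x i j)
  noise_law : ∀ t < T, P.map (ε t) = Measure.pi fun i => Measure.pi (M.noiseLaw i)
  noise_indep : ∀ t < T,
    IndepFun (ε t) (fun x (u : Fin (t + 1)) => (s u x, a u x)) P

end Model

end NetworkedMARL

end

/-!
The proof is the bracketing argument for the consistency of maximum likelihood, carried out for each
agent separately and followed by a union bound over the agents. The joint estimator maximises the
likelihood of every single agent (`IsMLE.likelihood_le`), because the average log-likelihood is a sum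
of functions of the separate factors that is finite at the true factor.

Fix an agent with true factor `wstar` and a factor `w` at distance at least `r` from it. The factors
at distance at most `η` from `w` have transition densities bounded by a single function `u`, the
bracket (`RegularFamily.agentDensity_le_upperBracket`): moving the factor by `η` moves the noise that
explains an observation by at most `L η / κ`, and a noise density of variation at most `V` exceeds its
value by at most its variation on the interval covered. These local variations have a total integral
of at most `2 V L η / κ`, so `u` has mass at most `1 + O(η)` (`RegularFamily.lintegral_upperBracket_le`).

By separation, the laws of `w` and `wstar` differ by at least `α r / 2` on some event. Applying the
Cauchy–Schwarz inequality on this event and on its complement shows that `√(u / p_wstar)` has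
conditional expectation at most `1 - α² r² / 16 + 2 √γ`, with `γ` the excess mass of `u`
(`RegularFamily.lintegral_sqrt_ratio_le`). As the noise is independent of the past, these factors
multiply along the trajectory, whatever the actions do (`IsDriven.lintegral_prod_le_pow`). With `η` of
order `1 / T²` the excess mass costs only a bounded factor over `T` steps, so some factor near `w` has a
likelihood at least that of the truth with probability at most `exp (1 - T α² r² / 16)`.

Total variation distances are at most `1`, so separation forces each factor space to have radius at
most `1 / α`. It is therefore covered by `O(T³)^d` small cubes when `d ≤ T`, with a constant that
does not depend on `d` or on the diameter (`RegularFamily.measure_far_le_of_grid`); when `d ≥ T`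
the claimed bound exceeds the radius. Choosing `r² = C² d log (n T / δ) / T` makes the
failure probability of each agent at most `δ / n` (`RegularFamily.measure_far_le`). The bound on the
whole vector is the sum of the squares of the bounds of the agents, and the bounds in terms of
the diameter follow because `d_i ≤ d`.
-/

/-! ### Change of variables for increasing maps of the line -/

section ChangeOfVariables

variable {g : ℝ → ℝ} {κ : ℝ}

theorem differentiable_of_le_deriv (hκ : 0 < κ) (hg : ∀ e, κ ≤ deriv g e) : Differentiable ℝ g :=
  fun e => differentiableAt_of_deriv_ne_zero (hκ.trans_le (hg e)).ne'

theorem mul_sub_le_sub_of_le_deriv (hκ : 0 < κ) (hg : ∀ e, κ ≤ deriv g e) {x y : ℝ} (h : x ≤ y) :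
    κ * (y - x) ≤ g y - g x :=
  mul_sub_le_image_sub_of_le_deriv (differentiable_of_le_deriv hκ hg) hg h

theorem strictMono_of_le_deriv (hκ : 0 < κ) (hg : ∀ e, κ ≤ deriv g e) : StrictMono g :=
  strictMono_of_deriv_pos fun e => hκ.trans_le (hg e)

theorem surjective_of_le_deriv (hκ : 0 < κ) (hg : ∀ e, κ ≤ deriv g e) : Function.Surjective g := by
  have hc := (differentiable_of_le_deriv hκ hg).continuous
  refine hc.surjective ?_ ?_
  · have h1 : Filter.Tendsto (fun x : ℝ => g 0 + κ * x) Filter.atTop Filter.atTop :=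
      Filter.tendsto_atTop_add_const_left _ _ (Filter.tendsto_id.const_mul_atTop hκ)
    refine Filter.tendsto_atTop_mono' _ ?_ h1
    filter_upwards [Filter.eventually_ge_atTop 0] with x hx
    have := mul_sub_le_sub_of_le_deriv hκ hg hx
    linarith
  · have h1 : Filter.Tendsto (fun x : ℝ => g 0 + κ * x) Filter.atBot Filter.atBot :=
      Filter.tendsto_atBot_add_const_left _ _ (Filter.tendsto_id.const_mul_atBot hκ)
    refine Filter.tendsto_atBot_mono' _ ?_ h1
    filter_upwards [Filter.eventually_le_atBot 0] with x hx
    have := mul_sub_le_sub_of_le_deriv hκ hg hx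
    linarith

theorem apply_invFun_of_le_deriv (hκ : 0 < κ) (hg : ∀ e, κ ≤ deriv g e) (y : ℝ) :
    g (Function.invFun g y) = y :=
  Function.invFun_eq (surjective_of_le_deriv hκ hg y)

theorem invFun_apply_of_le_deriv (hκ : 0 < κ) (hg : ∀ e, κ ≤ deriv g e) (e : ℝ) :
    Function.invFun g (g e) = e :=
  Function.leftInverse_invFun (strictMono_of_le_deriv hκ hg).injective e

theorem invFun_le_iff_of_le_deriv (hκ : 0 < κ) (hg : ∀ e, κ ≤ deriv g e) (y x : ℝ) :
    Function.invFun g y ≤ x ↔ y ≤ g x := by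
  rw [← (strictMono_of_le_deriv hκ hg).le_iff_le, apply_invFun_of_le_deriv hκ hg]

theorem measurable_invFun_of_le_deriv (hκ : 0 < κ) (hg : ∀ e, κ ≤ deriv g e) :
    Measurable (Function.invFun g) :=
  Monotone.measurable fun x y h =>
    (invFun_le_iff_of_le_deriv hκ hg _ _).2 (by rwa [apply_invFun_of_le_deriv hκ hg])

/-- The density at `y` of the image under `e ↦ g e` of the measure with density `h`. -/
noncomputable def pushDensity (h : ℝ → ℝ≥0∞) (g : ℝ → ℝ) (y : ℝ) : ℝ≥0∞ :=
  h (Function.invFun g y) / ENNReal.ofReal (deriv g (Function.invFun g y))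

theorem measurable_pushDensity (hκ : 0 < κ) (hg : ∀ e, κ ≤ deriv g e) {h : ℝ → ℝ≥0∞}
    (hh : Measurable h) : Measurable (pushDensity h g) := by
  have hi := measurable_invFun_of_le_deriv hκ hg
  exact (hh.comp hi).div (((measurable_deriv g).comp hi).ennreal_ofReal)

theorem map_withDensity_eq_pushDensity (hκ : 0 < κ) (hg : ∀ e, κ ≤ deriv g e) (h : ℝ → ℝ≥0∞) :
    (volume.withDensity h).map g = volume.withDensity (pushDensity h g) := by
  have hd := differentiable_of_le_deriv hκ hg
  have hm := strictMono_of_le_deriv hκ hg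
  ext A hA
  rw [Measure.map_apply hd.continuous.measurable hA,
    withDensity_apply _ (hd.continuous.measurable hA), withDensity_apply _ hA]
  conv_rhs => rw [← Set.image_preimage_eq A (surjective_of_le_deriv hκ hg)]
  rw [lintegral_image_eq_lintegral_deriv_mul_of_monotoneOn (hd.continuous.measurable hA)
    (fun x _ => (hd x).hasDerivAt.hasDerivWithinAt) (hm.monotone.monotoneOn _)]
  refine lintegral_congr fun e => ?_
  have hpos : 0 < deriv g e := hκ.trans_le (hg e)
  rw [pushDensity, invFun_apply_of_le_deriv hκ hg, ENNReal.mul_div_cancel]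
  · simpa using hpos
  · exact ENNReal.ofReal_ne_top

end ChangeOfVariables

/-! ### Products of densities -/

theorem lintegral_pi_prod {k : ℕ} (μ : Fin k → Measure ℝ) [∀ j, SigmaFinite (μ j)]
    (h : Fin k → ℝ → ℝ≥0∞) (hh : ∀ j, Measurable (h j)) :
    ∫⁻ y, ∏ j, h j (y j) ∂(Measure.pi μ) = ∏ j, ∫⁻ x, h j x ∂(μ j) := by
  induction k with
  | zero => simp
  | succ k ih =>
    rw [← ((measurePreserving_piFinSuccAbove μ 0).symm).lintegral_comp_emb
      (MeasurableEquiv.measurableEmbedding _)]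
    simp only [Fin.prod_univ_succ, MeasurableEquiv.piFinSuccAbove_symm_apply, Fin.insertNthEquiv,
      Equiv.coe_fn_mk, Fin.insertNth_zero, Fin.cons_zero, Fin.cons_succ]
    rw [← ih (fun j => μ j.succ) (fun j => h j.succ) fun j => hh _]
    exact lintegral_prod_mul (hh 0).aemeasurable
      (Finset.measurable_fun_prod _ fun j _ => (hh _).comp (measurable_pi_apply j)).aemeasurable

theorem pi_withDensity {k : ℕ} (h : Fin k → ℝ → ℝ≥0∞) (hh : ∀ j, Measurable (h j))
    [∀ j, SigmaFinite (volume.withDensity (h j))] :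
    Measure.pi (fun j => volume.withDensity (h j)) =
      (volume : Measure (Fin k → ℝ)).withDensity fun y => ∏ j, h j (y j) := by
  refine Measure.pi_eq fun s hs => ?_
  rw [withDensity_apply _ (MeasurableSet.univ_pi hs), ← lintegral_indicator (MeasurableSet.univ_pi hs)]
  have : ∀ y : Fin k → ℝ, (Set.univ.pi s).indicator (fun y => ∏ j, h j (y j)) y =
      ∏ j, (s j).indicator (h j) (y j) := by
    intro y
    by_cases hy : y ∈ Set.univ.pi s
    · rw [Set.indicator_of_mem hy]
      exact Finset.prod_congr rfl fun j _ => (Set.indicator_of_mem (hy j trivial) _).symm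
    · rw [Set.indicator_of_notMem hy]
      obtain ⟨j, hj⟩ : ∃ j, y j ∉ s j := by simpa [Set.mem_pi] using hy
      exact (Finset.prod_eq_zero (Finset.mem_univ j) (Set.indicator_of_notMem hj _)).symm
  simp_rw [this]
  rw [volume_pi, lintegral_pi_prod _ _ fun j => (hh j).indicator (hs j)]
  exact Finset.prod_congr rfl fun j _ => by
    rw [lintegral_indicator (hs j), withDensity_apply _ (hs j)]

/-- Coordinatewise images of a product of measures with finite densities. -/
theorem map_pi_withDensity {k : ℕ} {κ : ℝ} (hκ : 0 < κ) (h : Fin k → ℝ → ℝ≥0∞)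
    (hh : ∀ j, Measurable (h j)) [∀ j, IsFiniteMeasure (volume.withDensity (h j))]
    (g : Fin k → ℝ → ℝ) (hg : ∀ j e, κ ≤ deriv (g j) e) :
    (Measure.pi fun j => volume.withDensity (h j)).map (fun e j => g j (e j)) =
      (volume : Measure (Fin k → ℝ)).withDensity fun y => ∏ j, pushDensity (h j) (g j) (y j) := by
  have hgm : ∀ j, Measurable (g j) := fun j =>
    (differentiable_of_le_deriv hκ (hg j)).continuous.measurable
  have key : ∀ j, (volume.withDensity (h j)).map (g j) =
      volume.withDensity (pushDensity (h j) (g j)) := fun j =>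
    map_withDensity_eq_pushDensity hκ (hg j) _
  have hfin : ∀ j, IsFiniteMeasure (volume.withDensity (pushDensity (h j) (g j))) := fun j => by
    rw [← key]; infer_instance
  rw [← pi_withDensity _ fun j => measurable_pushDensity hκ (hg j) (hh j)]
  simp_rw [← key]
  exact Measure.pi_map_pi fun j => (hgm j).aemeasurable

theorem lintegral_pushDensity {g : ℝ → ℝ} {κ : ℝ} (hκ : 0 < κ) (hg : ∀ e, κ ≤ deriv g e)
    (h : ℝ → ℝ≥0∞) : ∫⁻ y, pushDensity h g y = ∫⁻ e, h e := by
  have := congrArg (fun μ : Measure ℝ => μ Set.univ) (map_withDensity_eq_pushDensity hκ hg h)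
  simpa [Measure.map_apply (differentiable_of_le_deriv hκ hg).continuous.measurable
    MeasurableSet.univ] using this.symm

/-! ### Densities of bounded variation -/

section Variation

variable {q : ℝ → ℝ≥0}

/-- The variation of `q` on the interval of radius `ρ` about `e`. -/
noncomputable def localVariation (q : ℝ → ℝ≥0) (ρ e : ℝ) : ℝ≥0∞ :=
  eVariationOn q (Set.Icc (e - ρ) (e + ρ))

theorem apply_le_add_localVariation {ρ e e' : ℝ} (h : |e' - e| ≤ ρ) :
    (q e' : ℝ≥0∞) ≤ q e + localVariation q ρ e := by
  have hρ : 0 ≤ ρ := (abs_nonneg _).trans h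
  rw [abs_le] at h
  have h1 : edist (q e') (q e) ≤ localVariation q ρ e :=
    eVariationOn.edist_le q ⟨by linarith, by linarith⟩ ⟨by linarith, by linarith⟩
  refine le_trans ?_ (add_le_add_right h1 _)
  rw [edist_dist, NNReal.dist_eq]
  have h2 : (q e' : ℝ) ≤ q e + |(q e' : ℝ) - q e| := by linarith [le_abs_self ((q e' : ℝ) - q e)]
  calc (q e' : ℝ≥0∞) = ENNReal.ofReal (q e') := (ENNReal.ofReal_coe_nnreal).symm
    _ ≤ ENNReal.ofReal (q e + |(q e' : ℝ) - q e|) := ENNReal.ofReal_le_ofReal h2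
    _ = _ := by
      rw [ENNReal.ofReal_add (by positivity) (by positivity), ENNReal.ofReal_coe_nnreal]

theorem eVariationOn_Iic_add_localVariation {ρ : ℝ} (hρ : 0 ≤ ρ) (e : ℝ) :
    eVariationOn q (Set.Iic (e - ρ)) + localVariation q ρ e = eVariationOn q (Set.Iic (e + ρ)) := by
  rw [localVariation, ← eVariationOn.union q (isGreatest_Iic) (isLeast_Icc (by linarith)),
    Set.Iic_union_Icc_eq_Iic (by linarith)]

variable (hq : eVariationOn q Set.univ ≠ ∞)
include hq

theorem eVariationOn_Iic_ne_top (x : ℝ) : eVariationOn q (Set.Iic x) ≠ ∞ :=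
  ne_top_of_le_ne_top hq (eVariationOn.mono q (Set.subset_univ _))

theorem localVariation_eq_sub {ρ : ℝ} (hρ : 0 ≤ ρ) (e : ℝ) :
    localVariation q ρ e = eVariationOn q (Set.Iic (e + ρ)) - eVariationOn q (Set.Iic (e - ρ)) := by
  rw [← eVariationOn_Iic_add_localVariation hρ,
    ENNReal.add_sub_cancel_left (eVariationOn_Iic_ne_top hq _)]

omit hq in
theorem measurable_eVariationOn_Iic : Measurable fun x => eVariationOn q (Set.Iic x) :=
  Monotone.measurable fun _ _ h => eVariationOn.mono q (Set.Iic_subset_Iic.2 h)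

theorem measurable_localVariation {ρ : ℝ} (hρ : 0 ≤ ρ) : Measurable (localVariation q ρ) := by
  rw [show localVariation q ρ = _ from funext fun e => localVariation_eq_sub hq hρ e]
  exact (measurable_eVariationOn_Iic.comp (measurable_id.add_const ρ)).sub
    (measurable_eVariationOn_Iic.comp (measurable_id.sub_const ρ))

/-- For each level `v`, the points `e` with `W (e - ρ) ≤ v < W (e + ρ)`, where `W x` is the variation
on `(-∞, x]`, form a set of diameter at most `2 ρ`; integrate over the levels and exchange the two
integrals. -/
theorem lintegral_localVariation_le {ρ : ℝ} (hρ : 0 ≤ ρ) {V : ℝ}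
    (hV : eVariationOn q Set.univ ≤ ENNReal.ofReal V) :
    ∫⁻ e, localVariation q ρ e ≤ ENNReal.ofReal (2 * ρ * V) := by
  set W : ℝ → ℝ := fun x => (eVariationOn q (Set.Iic x)).toReal with hW
  have hWm : Monotone W := fun x y h => ENNReal.toReal_mono (eVariationOn_Iic_ne_top hq _)
    (eVariationOn.mono q (Set.Iic_subset_Iic.2 h))
  have hloc : ∀ e, localVariation q ρ e = volume (Set.Ico (W (e - ρ)) (W (e + ρ))) := fun e => by
    rw [Real.volume_Ico, ENNReal.ofReal_sub _ ENNReal.toReal_nonneg, localVariation_eq_sub hq hρ,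
      ENNReal.ofReal_toReal (eVariationOn_Iic_ne_top hq _),
      ENNReal.ofReal_toReal (eVariationOn_Iic_ne_top hq _)]
  set S : Set (ℝ × ℝ) := {p | W (p.1 - ρ) ≤ p.2 ∧ p.2 < W (p.1 + ρ)} with hS
  have hSm : MeasurableSet S :=
    (measurableSet_le (hWm.measurable.comp (measurable_fst.sub_const ρ)) measurable_snd).inter
      (measurableSet_lt measurable_snd (hWm.measurable.comp (measurable_fst.add_const ρ)))
  have h1 : ∫⁻ e, localVariation q ρ e = (volume.prod volume) S := by
    rw [Measure.prod_apply hSm]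
    exact lintegral_congr fun e => hloc e
  rw [h1, Measure.prod_apply_symm hSm]
  have h2 : ∀ v, volume ((fun e => (e, v)) ⁻¹' S) ≤
      (Set.Ico 0 V).indicator (fun _ => ENNReal.ofReal (2 * ρ)) v := by
    intro v
    by_cases hv : v ∈ Set.Ico 0 V
    · rw [Set.indicator_of_mem hv]
      refine (Real.volume_le_diam _).trans (Metric.ediam_le fun x hx y hy => ?_)
      have hlt : ∀ {x y : ℝ}, (x, v) ∈ S → (y, v) ∈ S → x - y ≤ 2 * ρ := by
        intro x y hx hy
        by_contra hlt
        have := hWm (show y + ρ ≤ x - ρ by linarith)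
        exact absurd (hy.2.trans_le this) (not_lt.2 hx.1)
      rw [edist_dist, Real.dist_eq]
      exact ENNReal.ofReal_le_ofReal (abs_le.2 ⟨by linarith [hlt hy hx], hlt hx hy⟩)
    · rw [Set.indicator_of_notMem hv]
      have : ((fun e => (e, v)) ⁻¹' S) = ∅ := by
        refine Set.eq_empty_of_forall_notMem fun e he => hv ⟨ENNReal.toReal_nonneg.trans he.1, ?_⟩
        refine he.2.trans_le ?_
        have hVn : 0 ≤ V := by
          by_contra hneg
          have h0 : eVariationOn q (Set.Iic (e + ρ)) = 0 := le_antisymm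
            ((eVariationOn.mono q (Set.subset_univ _)).trans
              (hV.trans (ENNReal.ofReal_of_nonpos (by linarith)).le)) bot_le
          have h3 := he.1.trans_lt he.2
          have h4 : W (e + ρ) = 0 := by simp [hW, h0]
          have h5 : 0 ≤ W (e - ρ) := ENNReal.toReal_nonneg
          simp only at h3
          linarith
        exact ENNReal.toReal_le_of_le_ofReal hVn ((eVariationOn.mono q (Set.subset_univ _)).trans hV)
      simp [this]
  refine (lintegral_mono h2).trans ?_
  rw [lintegral_indicator measurableSet_Ico, setLIntegral_const, Real.volume_Ico, sub_zero,
    ← ENNReal.ofReal_mul (by positivity)]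

omit hq in
theorem measurable_of_eVariationOn_ne_top (hq : eVariationOn q Set.univ ≠ ∞) : Measurable q := by
  have hr : LocallyBoundedVariationOn (fun x => (q x : ℝ)) Set.univ := by
    apply BoundedVariationOn.locallyBoundedVariationOn
    have : eVariationOn (fun x => (q x : ℝ)) Set.univ = eVariationOn q Set.univ := by
      simp only [eVariationOn, edist_dist, NNReal.dist_eq, Real.dist_eq]
    rw [BoundedVariationOn, this]
    exact hq
  obtain ⟨p, r, hp, hr, hpr⟩ := hr.exists_monotoneOn_sub_monotoneOn
  rw [monotoneOn_univ] at hp hr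
  have : Measurable fun x => (q x : ℝ) := by
    rw [hpr]; exact hp.measurable.sub hr.measurable
  simpa using this.real_toNNReal

end Variation

/-! ### The Hellinger affinity -/

theorem sqrt_mul_add_sqrt_mul_le {a b : ℝ} (ha : 0 ≤ a) (ha1 : a ≤ 1) (hb : 0 ≤ b) (hb1 : b ≤ 1) :
    √a * √b + √(1 - a) * √(1 - b) ≤ 1 - (a - b) ^ 2 / 4 := by
  have aux : ∀ {x y : ℝ}, 0 ≤ x → x ≤ 1 → 0 ≤ y → y ≤ 1 →
      √x * √y ≤ (x + y) / 2 - (x - y) ^ 2 / 8 := by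
    intro x y hx hx1 hy hy1
    have h1 := Real.mul_self_sqrt hx
    have h2 := Real.mul_self_sqrt hy
    have h3 : √x ≤ 1 := Real.sqrt_le_one.2 hx1
    have h4 : √y ≤ 1 := Real.sqrt_le_one.2 hy1
    have h5 := Real.sqrt_nonneg x
    have h6 := Real.sqrt_nonneg y
    have h7 : (x - y) ^ 2 = (√x - √y) ^ 2 * (√x + √y) ^ 2 := by
      rw [← h1, ← h2]; simp only [Real.sqrt_mul_self h5, Real.sqrt_mul_self h6]; ring
    have h8 : (√x + √y) ^ 2 ≤ 4 := by nlinarith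
    have h9 : (x - y) ^ 2 ≤ (√x - √y) ^ 2 * 4 := by
      rw [h7]; exact mul_le_mul_of_nonneg_left h8 (sq_nonneg _)
    nlinarith
  have h1 := aux ha ha1 hb hb1
  have h2 := aux (sub_nonneg.2 ha1) (by linarith) (sub_nonneg.2 hb1) (by linarith)
  nlinarith

theorem lintegral_sqrt_mul_sqrt_le {Y : Type*} [MeasurableSpace Y] (μ : Measure Y)
    {u p : Y → ℝ≥0∞} (hu : Measurable u) (hp : Measurable p) :
    ∫⁻ y, u y ^ (1 / 2 : ℝ) * p y ^ (1 / 2 : ℝ) ∂μ ≤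
      (∫⁻ y, u y ∂μ) ^ (1 / 2 : ℝ) * (∫⁻ y, p y ∂μ) ^ (1 / 2 : ℝ) := by
  have h := ENNReal.lintegral_mul_le_Lp_mul_Lq μ Real.HolderConjugate.two_two
    (hu.pow_const (1 / 2 : ℝ)).aemeasurable (hp.pow_const (1 / 2 : ℝ)).aemeasurable
  simp only [Pi.mul_apply, ← ENNReal.rpow_mul] at h
  norm_num at h
  norm_num
  exact h

theorem sqrt_div_mul_self_le (u p : ℝ≥0∞) :
    (u / p) ^ (1 / 2 : ℝ) * p ≤ u ^ (1 / 2 : ℝ) * p ^ (1 / 2 : ℝ) := by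
  rcases eq_or_ne p 0 with rfl | h0
  · simp
  rcases eq_or_ne p ∞ with rfl | ht
  · simp
  have hs : p = p ^ (1 / 2 : ℝ) * p ^ (1 / 2 : ℝ) := by
    rw [← ENNReal.rpow_add _ _ h0 ht]; norm_num
  have hs0 : p ^ (1 / 2 : ℝ) ≠ 0 := by simp [h0, ht]
  have hst : p ^ (1 / 2 : ℝ) ≠ ∞ := by simp [h0, ht]
  rw [ENNReal.div_rpow_of_nonneg _ _ (by norm_num)]
  nth_rw 2 [hs]
  rw [← mul_assoc, ENNReal.div_mul_cancel hs0 hst]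

/-- If `u` dominates the probability density `r` with excess mass at most `γ`, and the laws of
densities `p` and `r` differ by at least `τ` on some event, then under the law of density `p` the
expectation of `√(u / p)` is at most `1 - τ² / 4 + 2 √γ`. The Cauchy–Schwarz inequality on
the event and on its complement reduces this to the affinity of two Bernoulli laws. -/
theorem lintegral_sqrt_div_mul_le {Y : Type*} [MeasurableSpace Y] {μ : Measure Y}
    {p r u : Y → ℝ≥0∞} (hp : Measurable p) (hu : Measurable u)
    (hp1 : ∫⁻ y, p y ∂μ = 1) (hr1 : ∫⁻ y, r y ∂μ = 1) (hru : ∀ y, r y ≤ u y) {γ τ : ℝ} (hγ : 0 ≤ γ)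
    (hu1 : ∫⁻ y, u y ∂μ ≤ ENNReal.ofReal (1 + γ)) {A : Set Y} (hA : MeasurableSet A)
    (hτ0 : 0 ≤ τ) (hτ : τ ≤ |(μ.withDensity p).real A - (μ.withDensity r).real A|) :
    ∫⁻ y, (u y / p y) ^ (1 / 2 : ℝ) * p y ∂μ ≤ ENNReal.ofReal (1 - τ ^ 2 / 4 + 2 * √γ) := by
  have hprob : ∀ {f : Y → ℝ≥0∞}, ∫⁻ y, f y ∂μ = 1 → IsProbabilityMeasure (μ.withDensity f) :=
    fun h => ⟨by rw [withDensity_apply _ MeasurableSet.univ, setLIntegral_univ, h]⟩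
  have := hprob hp1
  have := hprob hr1
  set b := (μ.withDensity p).real A
  set a := (μ.withDensity r).real A
  -- an event of probability `x` under `r` has mass at most `x + γ` under `u`
  have hmass : ∀ {B : Set Y}, MeasurableSet B →
      ∫⁻ y in B, u y ∂μ ≤ ENNReal.ofReal ((μ.withDensity r).real B + γ) := by
    intro B hB
    have h1 : ∫⁻ y in B, u y ∂μ + ∫⁻ y in Bᶜ, u y ∂μ ≤ ENNReal.ofReal (1 + γ) := by
      rwa [lintegral_add_compl _ hB]
    have h2 : ENNReal.ofReal (1 - (μ.withDensity r).real B) ≤ ∫⁻ y in Bᶜ, u y ∂μ := by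
      rw [← probReal_compl_eq_one_sub hB, measureReal_def, ENNReal.ofReal_toReal (measure_ne_top _ _),
        withDensity_apply _ hB.compl]
      exact lintegral_mono hru
    have h3 : ENNReal.ofReal (1 + γ) = ENNReal.ofReal ((μ.withDensity r).real B + γ) +
        ENNReal.ofReal (1 - (μ.withDensity r).real B) := by
      rw [← ENNReal.ofReal_add (by positivity) (sub_nonneg.2 measureReal_le_one)]
      congr 1; ring
    rw [h3] at h1
    exact (ENNReal.add_le_add_iff_right ENNReal.ofReal_ne_top).1 ((add_le_add_right h2 _).trans h1)
  have hcs : ∀ {B : Set Y}, MeasurableSet B →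
      ∫⁻ y in B, u y ^ (1 / 2 : ℝ) * p y ^ (1 / 2 : ℝ) ∂μ ≤
        ENNReal.ofReal (√((μ.withDensity r).real B + γ) * √((μ.withDensity p).real B)) := by
    intro B hB
    refine (lintegral_sqrt_mul_sqrt_le _ hu hp).trans ?_
    have h1 : ∫⁻ y in B, p y ∂μ = ENNReal.ofReal ((μ.withDensity p).real B) := by
      rw [measureReal_def, ENNReal.ofReal_toReal (measure_ne_top _ _), withDensity_apply _ hB]
    rw [h1, ENNReal.ofReal_mul (by positivity), Real.sqrt_eq_rpow, Real.sqrt_eq_rpow,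
      ← ENNReal.ofReal_rpow_of_nonneg (by positivity) (by norm_num),
      ← ENNReal.ofReal_rpow_of_nonneg (by positivity) (by norm_num)]
    gcongr
    exact hmass hB
  calc ∫⁻ y, (u y / p y) ^ (1 / 2 : ℝ) * p y ∂μ
      ≤ ∫⁻ y, u y ^ (1 / 2 : ℝ) * p y ^ (1 / 2 : ℝ) ∂μ :=
        lintegral_mono fun y => sqrt_div_mul_self_le _ _
    _ = ∫⁻ y in A, u y ^ (1 / 2 : ℝ) * p y ^ (1 / 2 : ℝ) ∂μ +
        ∫⁻ y in Aᶜ, u y ^ (1 / 2 : ℝ) * p y ^ (1 / 2 : ℝ) ∂μ := (lintegral_add_compl _ hA).symm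
    _ ≤ ENNReal.ofReal (√(a + γ) * √b) + ENNReal.ofReal (√(1 - a + γ) * √(1 - b)) := by
        refine add_le_add (hcs hA) ?_
        have := hcs hA.compl
        rwa [probReal_compl_eq_one_sub hA, probReal_compl_eq_one_sub hA] at this
    _ = ENNReal.ofReal (√(a + γ) * √b + √(1 - a + γ) * √(1 - b)) :=
        (ENNReal.ofReal_add (by positivity) (by positivity)).symm
    _ ≤ ENNReal.ofReal (1 - τ ^ 2 / 4 + 2 * √γ) := by
        refine ENNReal.ofReal_le_ofReal ?_
        have ha : 0 ≤ a := measureReal_nonneg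
        have hb : 0 ≤ b := measureReal_nonneg
        have ha1 : a ≤ 1 := measureReal_le_one
        have hb1 : b ≤ 1 := measureReal_le_one
        have h1 := sqrt_mul_add_sqrt_mul_le ha ha1 hb hb1
        have h2 : τ ^ 2 ≤ (a - b) ^ 2 := by
          rw [← sq_abs (a - b), abs_sub_comm]; gcongr
        have aux : ∀ {x y : ℝ}, 0 ≤ x → y ≤ 1 → √(x + γ) * √y ≤ √x * √y + √γ := by
          intro x y hx hy
          have h3 : √(x + γ) ≤ √x + √γ := Real.sqrt_le_iff.2 ⟨by positivity, by
            nlinarith [Real.sq_sqrt hx, Real.sq_sqrt hγ,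
              mul_nonneg (Real.sqrt_nonneg x) (Real.sqrt_nonneg γ)]⟩
          have h4 : √y ≤ 1 := Real.sqrt_le_one.2 hy
          calc √(x + γ) * √y ≤ (√x + √γ) * √y := by gcongr
            _ = √x * √y + √γ * √y := by ring
            _ ≤ √x * √y + √γ * 1 := by gcongr
            _ = _ := by ring
        have h5 := aux ha hb1
        have h6 := aux (sub_nonneg.2 ha1) (show 1 - b ≤ 1 by linarith)
        linarith

/-! ### Measurability in a parameter -/

section Parameter

variable {Z : Type*} [MeasurableSpace Z] {g : Z → ℝ → ℝ} {κ : ℝ}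

theorem measurable_invFun_param (hκ : 0 < κ) (hg : ∀ z e, κ ≤ deriv (g z) e)
    (hm : Measurable fun p : Z × ℝ => g p.1 p.2) :
    Measurable fun p : Z × ℝ => Function.invFun (g p.1) p.2 := by
  refine measurable_of_Iic fun x => ?_
  have : (fun p : Z × ℝ => Function.invFun (g p.1) p.2) ⁻¹' Set.Iic x =
      {p : Z × ℝ | p.2 ≤ g p.1 x} := by
    ext p
    exact invFun_le_iff_of_le_deriv hκ (hg p.1) p.2 x
  rw [this]
  exact measurableSet_le measurable_snd
    (hm.comp (measurable_fst.prodMk measurable_const) : Measurable fun p : Z × ℝ => g p.1 x)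

theorem measurable_deriv_param (hd : ∀ z, Differentiable ℝ (g z))
    (hm : Measurable fun p : Z × ℝ => g p.1 p.2) :
    Measurable fun p : Z × ℝ => deriv (g p.1) p.2 := by
  refine measurable_of_tendsto_metrizable
    (f := fun (i : ℕ) (p : Z × ℝ) => ((1 : ℝ) / (i + 1))⁻¹ * (g p.1 (p.2 + 1 / (i + 1)) - g p.1 p.2))
    (fun i => ?_) ?_
  · exact ((hm.comp (measurable_fst.prodMk (measurable_snd.add_const _))).sub hm).const_mul _
  · rw [tendsto_pi_nhds]
    intro p
    have h := ((hd p.1 p.2).hasDerivAt).tendsto_slope_zero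
    refine h.comp (tendsto_nhdsWithin_iff.2
      ⟨tendsto_one_div_add_atTop_nhds_zero_nat, Filter.Eventually.of_forall fun i => ?_⟩)
    have : (0 : ℝ) < 1 / (i + 1) := by positivity
    exact this.ne'

theorem measurable_pushDensity_param (hκ : 0 < κ) (hg : ∀ z e, κ ≤ deriv (g z) e)
    (hm : Measurable fun p : Z × ℝ => g p.1 p.2) {h : ℝ → ℝ≥0∞} (hh : Measurable h) :
    Measurable fun p : Z × ℝ => pushDensity h (g p.1) p.2 := by
  have hi := measurable_invFun_param hκ hg hm
  have hd := measurable_deriv_param (fun z => differentiable_of_le_deriv hκ (hg z)) hm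
  exact (hh.comp hi).div ((hd.comp (measurable_fst.prodMk hi)).ennreal_ofReal)

end Parameter

/-! ### The transition densities of one agent -/

/-- The local model of one agent. The points `z` of `Z` are the admissible pairs of neighbouring
states and own action, `q j` is the density of the `j`-th noise variable, and `F j z w e` is the next
value of the `j`-th state component for the factor `w` and the noise `e`. -/
structure RegularFamily {k : ℕ} {Z E : Type*} [MeasurableSpace Z] [NormedAddCommGroup E]
    (Ω : Set E) (q : Fin k → ℝ → ℝ≥0) (F : Fin k → Z → E → ℝ → ℝ) (V L κ K : ℝ) : Prop where
  L_nonneg : 0 ≤ L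
  V_nonneg : 0 ≤ V
  K_nonneg : 0 ≤ K
  κ_pos : 0 < κ
  isProb : ∀ j, IsProbabilityMeasure (volume.withDensity fun e => (q j e : ℝ≥0∞))
  variation_le : ∀ j, eVariationOn (q j) Set.univ ≤ ENNReal.ofReal V
  measurable_map : ∀ j, ∀ w ∈ Ω, Measurable fun p : Z × ℝ => F j p.1 w p.2
  lipschitz_factor : ∀ j z, ∀ w ∈ Ω, ∀ w' ∈ Ω, ∀ e, |F j z w e - F j z w' e| ≤ L * ‖w - w'‖
  le_deriv : ∀ j z, ∀ w ∈ Ω, ∀ e, κ ≤ deriv (F j z w) e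
  lipschitz_deriv : ∀ j z, ∀ w ∈ Ω, ∀ w' ∈ Ω, ∀ e e',
    |deriv (F j z w) e - deriv (F j z w') e'| ≤ K * (‖w - w'‖ + |e - e'|)

section Agent

variable {k : ℕ} {Z E : Type*} [MeasurableSpace Z] [NormedAddCommGroup E]

/-- The joint law of the noise variables of one agent at one time. -/
noncomputable def agentNoise (q : Fin k → ℝ → ℝ≥0) : Measure (Fin k → ℝ) :=
  Measure.pi fun j => volume.withDensity fun e => (q j e : ℝ≥0∞)

/-- The density of the next state of one agent. -/
noncomputable def agentDensity (q : Fin k → ℝ → ℝ≥0) (F : Fin k → Z → E → ℝ → ℝ) (w : E) (z : Z)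
    (y : Fin k → ℝ) : ℝ≥0∞ :=
  ∏ j, pushDensity (fun e => (q j e : ℝ≥0∞)) (F j z w) (y j)

/-- A common upper bound for the densities of the factors at distance at most `η` from `w`: such a
factor changes the noise that leads to a given state by at most `L η / κ`, and the
derivative there by a factor of at most `1 + K (η + L η / κ) / κ`. -/
noncomputable def upperBracket (q : Fin k → ℝ → ℝ≥0) (F : Fin k → Z → E → ℝ → ℝ) (L κ K η : ℝ)
    (w : E) (z : Z) (y : Fin k → ℝ) : ℝ≥0∞ :=
  ∏ j, ENNReal.ofReal (1 + K * (η + L * η / κ) / κ) *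
    pushDensity (fun e => (q j e : ℝ≥0∞) + localVariation (q j) (L * η / κ) e) (F j z w) (y j)

variable {Ω : Set E} {q : Fin k → ℝ → ℝ≥0} {F : Fin k → Z → E → ℝ → ℝ} {V L κ K : ℝ}

namespace RegularFamily

variable (H : RegularFamily Ω q F V L κ K)
include H

theorem variation_ne_top (j : Fin k) : eVariationOn (q j) Set.univ ≠ ∞ :=
  ne_top_of_le_ne_top ENNReal.ofReal_ne_top (H.variation_le j)

theorem measurable_noise_density (j : Fin k) : Measurable fun e => (q j e : ℝ≥0∞) :=
  (measurable_of_eVariationOn_ne_top (H.variation_ne_top j)).coe_nnreal_ennreal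

theorem isProbabilityMeasure_agentNoise : IsProbabilityMeasure (agentNoise q) := by
  have := H.isProb
  unfold agentNoise
  infer_instance

theorem law_eq {w : E} (hw : w ∈ Ω) (z : Z) :
    (agentNoise q).map (fun e j => F j z w (e j)) = volume.withDensity (agentDensity q F w z) := by
  have := H.isProb
  exact map_pi_withDensity H.κ_pos _ H.measurable_noise_density (fun j => F j z w)
    fun j e => H.le_deriv j z w hw e

theorem measurable_next (w : E) (hw : w ∈ Ω) :
    Measurable fun p : Z × (Fin k → ℝ) => fun j => F j p.1 w (p.2 j) :=
  measurable_pi_lambda _ fun j => (H.measurable_map j w hw).comp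
    (measurable_fst.prodMk ((measurable_pi_apply j).comp measurable_snd))

theorem measurable_agentDensity {w : E} (hw : w ∈ Ω) :
    Measurable fun p : Z × (Fin k → ℝ) => agentDensity q F w p.1 p.2 :=
  Finset.measurable_fun_prod _ fun j _ =>
    (measurable_pushDensity_param H.κ_pos (fun z => H.le_deriv j z w hw) (H.measurable_map j w hw)
      (H.measurable_noise_density j)).comp
      (measurable_fst.prodMk ((measurable_pi_apply j).comp measurable_snd))

theorem radius_nonneg {η : ℝ} (hη : 0 ≤ η) : 0 ≤ L * η / κ :=
  div_nonneg (mul_nonneg H.L_nonneg hη) H.κ_pos.le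

theorem measurable_bracket_density {η : ℝ} (hη : 0 ≤ η) (j : Fin k) :
    Measurable fun e => (q j e : ℝ≥0∞) + localVariation (q j) (L * η / κ) e :=
  (H.measurable_noise_density j).add
    (measurable_localVariation (H.variation_ne_top j) (H.radius_nonneg hη))

theorem measurable_upperBracket {η : ℝ} (hη : 0 ≤ η) {w : E} (hw : w ∈ Ω) :
    Measurable fun p : Z × (Fin k → ℝ) => upperBracket q F L κ K η w p.1 p.2 :=
  Finset.measurable_fun_prod _ fun j _ => Measurable.const_mul
    ((measurable_pushDensity_param H.κ_pos (fun z => H.le_deriv j z w hw) (H.measurable_map j w hw)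
      (H.measurable_bracket_density hη j)).comp
      (measurable_fst.prodMk ((measurable_pi_apply j).comp measurable_snd))) _

theorem abs_invFun_sub_le {w w' : E} (hw : w ∈ Ω) (hw' : w' ∈ Ω) {η : ℝ} (h : ‖w - w'‖ ≤ η)
    (j : Fin k) (z : Z) (y : ℝ) :
    |Function.invFun (F j z w) y - Function.invFun (F j z w') y| ≤ L * η / κ := by
  set x := Function.invFun (F j z w) y
  set x' := Function.invFun (F j z w') y
  have hx : F j z w x = y := apply_invFun_of_le_deriv H.κ_pos (H.le_deriv j z w hw) y
  have hx' : F j z w' x' = y := apply_invFun_of_le_deriv H.κ_pos (H.le_deriv j z w' hw') y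
  have h1 := H.lipschitz_factor j z w hw w' hw' x
  have h2 : |F j z w' x - F j z w' x'| ≤ L * η := by
    rw [hx', ← hx, abs_sub_comm]
    exact h1.trans (mul_le_mul_of_nonneg_left h H.L_nonneg)
  rw [le_div_iff₀ H.κ_pos, mul_comm]
  rcases le_total x x' with hle | hle
  · have h3 := mul_sub_le_sub_of_le_deriv H.κ_pos (H.le_deriv j z w' hw') hle
    rw [abs_sub_comm, abs_of_nonneg (sub_nonneg.2 hle)]
    rw [abs_sub_comm] at h2
    exact h3.trans ((le_abs_self _).trans h2)
  · have h3 := mul_sub_le_sub_of_le_deriv H.κ_pos (H.le_deriv j z w' hw') hle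
    rw [abs_of_nonneg (sub_nonneg.2 hle)]
    exact h3.trans ((le_abs_self _).trans h2)

theorem agentDensity_le_upperBracket {w w' : E} (hw : w ∈ Ω) (hw' : w' ∈ Ω) {η : ℝ}
    (h : ‖w - w'‖ ≤ η) (z : Z) (y : Fin k → ℝ) :
    agentDensity q F w z y ≤ upperBracket q F L κ K η w' z y := by
  refine Finset.prod_le_prod' fun j _ => ?_
  have hinv := H.abs_invFun_sub_le hw hw' h j z (y j)
  set x := Function.invFun (F j z w) (y j) with hx
  set x' := Function.invFun (F j z w') (y j) with hx'
  have hκ := H.κ_pos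
  have hd := H.le_deriv j z w hw x
  have hd' := H.le_deriv j z w' hw' x'
  have hη : 0 ≤ η := (norm_nonneg _).trans h
  have hρ := H.radius_nonneg hη
  set β := K * (η + L * η / κ) / κ with hβ
  have hβ0 : 0 ≤ β := div_nonneg (mul_nonneg H.K_nonneg (add_nonneg hη hρ)) hκ.le
  have h1 : deriv (F j z w') x' ≤ (1 + β) * deriv (F j z w) x := by
    have h2 := H.lipschitz_deriv j z w hw w' hw' x x'
    have h3 : K * (‖w - w'‖ + |x - x'|) ≤ K * (η + L * η / κ) :=
      mul_le_mul_of_nonneg_left (add_le_add h hinv) H.K_nonneg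
    have h4 : K * (η + L * η / κ) = β * κ := by rw [hβ]; field_simp
    have h5 : β * κ ≤ β * deriv (F j z w) x := mul_le_mul_of_nonneg_left hd hβ0
    have h6 := (abs_le.1 (h2.trans h3)).1
    linarith
  have h0 : 0 < deriv (F j z w) x := hκ.trans_le hd
  have h0' : 0 < deriv (F j z w') x' := hκ.trans_le hd'
  have h2 : (ENNReal.ofReal (deriv (F j z w) x))⁻¹ ≤
      ENNReal.ofReal (1 + β) * (ENNReal.ofReal (deriv (F j z w') x'))⁻¹ := by
    rw [← ENNReal.ofReal_inv_of_pos h0, ← ENNReal.ofReal_inv_of_pos h0',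
      ← ENNReal.ofReal_mul (by positivity)]
    refine ENNReal.ofReal_le_ofReal ?_
    rw [← div_eq_mul_inv, le_div_iff₀ h0', inv_mul_le_iff₀ h0]
    linarith
  rw [pushDensity, pushDensity, ← hx, ← hx', div_eq_mul_inv, div_eq_mul_inv, mul_left_comm]
  exact mul_le_mul' (apply_le_add_localVariation hinv) h2

/-- The total mass of the upper bracket. -/
theorem lintegral_upperBracket_le {w : E} (hw : w ∈ Ω) {η : ℝ} (hη : 0 ≤ η) (z : Z) :
    ∫⁻ y, upperBracket q F L κ K η w z y ≤
      ENNReal.ofReal (((1 + K * (η + L * η / κ) / κ) * (1 + 2 * (L * η / κ) * V)) ^ k) := by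
  have hκ := H.κ_pos
  have hρ := H.radius_nonneg hη
  have hV := H.V_nonneg
  have hβ0 : 0 ≤ K * (η + L * η / κ) / κ :=
    div_nonneg (mul_nonneg H.K_nonneg (add_nonneg hη hρ)) hκ.le
  unfold upperBracket
  rw [volume_pi, lintegral_pi_prod (fun _ => volume)
    (fun j x => ENNReal.ofReal (1 + K * (η + L * η / κ) / κ) *
      pushDensity (fun e => (q j e : ℝ≥0∞) + localVariation (q j) (L * η / κ) e) (F j z w) x)
    fun j => (measurable_pushDensity hκ (H.le_deriv j z w hw)
      (H.measurable_bracket_density hη j)).const_mul _]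
  have : ∀ j ∈ (Finset.univ : Finset (Fin k)), ∫⁻ x, ENNReal.ofReal (1 + K * (η + L * η / κ) / κ) *
      pushDensity (fun e => (q j e : ℝ≥0∞) + localVariation (q j) (L * η / κ) e) (F j z w) x ≤
      ENNReal.ofReal ((1 + K * (η + L * η / κ) / κ) * (1 + 2 * (L * η / κ) * V)) := by
    intro j _
    rw [lintegral_const_mul _ (measurable_pushDensity hκ (H.le_deriv j z w hw)
      (H.measurable_bracket_density hη j)), lintegral_pushDensity hκ (H.le_deriv j z w hw),
      lintegral_add_left (H.measurable_noise_density j), ENNReal.ofReal_mul (by positivity)]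
    refine mul_le_mul' le_rfl ?_
    rw [ENNReal.ofReal_add zero_le_one (by positivity), ENNReal.ofReal_one]
    refine add_le_add ?_ ?_
    · have := (H.isProb j).measure_univ
      rw [withDensity_apply _ MeasurableSet.univ, setLIntegral_univ] at this
      exact this.le
    · exact lintegral_localVariation_le (H.variation_ne_top j) hρ (H.variation_le j)
  refine (Finset.prod_le_prod' this).trans ?_
  rw [Finset.prod_const, Finset.card_univ, Fintype.card_fin, ENNReal.ofReal_pow (by positivity)]

theorem measurable_agentDensity_apply {w : E} (hw : w ∈ Ω) (z : Z) :
    Measurable (agentDensity q F w z) :=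
  Measurable.of_uncurry_left (f := agentDensity q F w) (H.measurable_agentDensity hw)

theorem lintegral_agentDensity {w : E} (hw : w ∈ Ω) (z : Z) :
    ∫⁻ y, agentDensity q F w z y = 1 := by
  have := H.isProbabilityMeasure_agentNoise
  have hm : Measurable fun e : Fin k → ℝ => fun j => F j z w (e j) :=
    (H.measurable_next w hw).comp measurable_prodMk_left
  have h := congrArg (fun μ : Measure (Fin k → ℝ) => μ Set.univ) (H.law_eq hw z)
  simp only [Measure.map_apply hm MeasurableSet.univ, Set.preimage_univ, measure_univ,
    withDensity_apply _ MeasurableSet.univ, setLIntegral_univ] at h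
  exact h.symm

end RegularFamily

theorem exists_half_le_of_le_tvDist {Y : Type*} [MeasurableSpace Y] {μ ν : Measure Y} {τ : ℝ}
    (hτ : 0 < τ) (h : τ ≤ NetworkedMARL.tvDist μ ν) :
    ∃ A, MeasurableSet A ∧ τ / 2 ≤ |μ.real A - ν.real A| := by
  by_contra! hcon
  have : Nonempty {A : Set Y // MeasurableSet A} := ⟨⟨∅, MeasurableSet.empty⟩⟩
  have : NetworkedMARL.tvDist μ ν ≤ τ / 2 := ciSup_le fun A => (hcon A.1 A.2).le
  linarith

theorem tvDist_le_one {Y : Type*} [MeasurableSpace Y] {μ ν : Measure Y} [IsProbabilityMeasure μ]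
    [IsProbabilityMeasure ν] : NetworkedMARL.tvDist μ ν ≤ 1 := by
  have : Nonempty {A : Set Y // MeasurableSet A} := ⟨⟨∅, MeasurableSet.empty⟩⟩
  refine ciSup_le fun A => abs_le.2 ⟨?_, ?_⟩ <;>
  linarith [measureReal_nonneg (μ := μ) (s := A.1), measureReal_nonneg (μ := ν) (s := A.1),
    measureReal_le_one (μ := μ) (s := A.1), measureReal_le_one (μ := ν) (s := A.1)]

namespace RegularFamily

variable (H : RegularFamily Ω q F V L κ K)
include H

/-- The one-step bound: at every admissible `z`, the square root of the ratio between the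
bracket about a factor `w` and the true density has an expectation below `1` by the
squared separation, up to the excess mass of the bracket. -/
theorem lintegral_sqrt_ratio_le {w wstar : E} (hw : w ∈ Ω) (hstar : wstar ∈ Ω) {η γ τ : ℝ}
    (hη : 0 ≤ η) (hγ : 0 ≤ γ)
    (hmass : ((1 + K * (η + L * η / κ) / κ) * (1 + 2 * (L * η / κ) * V)) ^ k ≤ 1 + γ)
    (hτ : 0 < τ) (z : Z)
    (hsep : τ ≤ NetworkedMARL.tvDist ((agentNoise q).map fun e j => F j z wstar (e j))
      ((agentNoise q).map fun e j => F j z w (e j))) :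
    ∫⁻ e, (upperBracket q F L κ K η w z (fun j => F j z wstar (e j)) /
        agentDensity q F wstar z (fun j => F j z wstar (e j))) ^ (1 / 2 : ℝ) ∂(agentNoise q) ≤
      ENNReal.ofReal (1 - τ ^ 2 / 16 + 2 * √γ) := by
  have hm : Measurable fun e : Fin k → ℝ => fun j => F j z wstar (e j) :=
    (H.measurable_next wstar hstar).comp measurable_prodMk_left
  have hum : Measurable (upperBracket q F L κ K η w z) :=
    Measurable.of_uncurry_left (f := upperBracket q F L κ K η w) (H.measurable_upperBracket hη hw)
  have hpm := H.measurable_agentDensity_apply hstar z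
  obtain ⟨A, hA, hA2⟩ := exists_half_le_of_le_tvDist hτ hsep
  rw [H.law_eq hw, H.law_eq hstar] at hA2
  have hbound := lintegral_sqrt_div_mul_le hpm hum
    (H.lintegral_agentDensity hstar z) (H.lintegral_agentDensity hw z)
    (H.agentDensity_le_upperBracket hw hw (by simpa using hη) z) hγ
    ((H.lintegral_upperBracket_le hw hη z).trans (ENNReal.ofReal_le_ofReal hmass)) hA
    (half_pos hτ).le hA2
  have hlaw := H.law_eq hstar z
  generalize upperBracket q F L κ K η w z = u at *
  generalize agentDensity q F wstar z = p at *
  have hR : Measurable fun y => (u y / p y) ^ (1 / 2 : ℝ) := (hum.div hpm).pow_const _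
  rw [← lintegral_map (f := fun y => (u y / p y) ^ (1 / 2 : ℝ)) hR hm, hlaw,
    lintegral_withDensity_eq_lintegral_mul _ hpm hR]
  calc ∫⁻ y, (p * fun y => (u y / p y) ^ (1 / 2 : ℝ)) y
      = ∫⁻ y, (u y / p y) ^ (1 / 2 : ℝ) * p y := lintegral_congr fun y => mul_comm _ _
    _ ≤ _ := hbound
    _ = _ := by congr 2; ring

end RegularFamily

end Agent

/-! ### Likelihood ratios along a trajectory -/

theorem lintegral_mul_le_of_indepFun {X 𝓗 𝓔 : Type*} [MeasurableSpace X] [MeasurableSpace 𝓗]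
    [MeasurableSpace 𝓔] {P : Measure X} [IsProbabilityMeasure P] {e : X → 𝓔} {h : X → 𝓗}
    (he : Measurable e) (hh : Measurable h) (hind : IndepFun e h P) {Φ : 𝓗 → ℝ≥0∞}
    (hΦ : Measurable Φ) {g : 𝓗 × 𝓔 → ℝ≥0∞} (hg : Measurable g) {A : ℝ≥0∞}
    (hA : ∀ a, ∫⁻ b, g (a, b) ∂(P.map e) ≤ A) :
    ∫⁻ x, Φ (h x) * g (h x, e x) ∂P ≤ A * ∫⁻ x, Φ (h x) ∂P := by
  have hmap := (indepFun_iff_map_prod_eq_prod_map_map hh.aemeasurable he.aemeasurable).1 hind.symm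
  have hm : Measurable fun p : 𝓗 × 𝓔 => Φ p.1 * g p := (hΦ.comp measurable_fst).mul hg
  have : IsProbabilityMeasure (P.map e) := Measure.isProbabilityMeasure_map he.aemeasurable
  have : IsProbabilityMeasure (P.map h) := Measure.isProbabilityMeasure_map hh.aemeasurable
  calc ∫⁻ x, Φ (h x) * g (h x, e x) ∂P
      = ∫⁻ p, Φ p.1 * g p ∂(P.map fun x => (h x, e x)) := (lintegral_map hm (hh.prodMk he)).symm
    _ = ∫⁻ a, ∫⁻ b, Φ a * g (a, b) ∂(P.map e) ∂(P.map h) := by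
        rw [hmap, lintegral_prod _ hm.aemeasurable]
    _ ≤ ∫⁻ a, A * Φ a ∂(P.map h) := lintegral_mono fun a => by
        rw [lintegral_const_mul (f := fun b => g (a, b)) _ (hg.comp measurable_prodMk_left), mul_comm]
        exact mul_le_mul' (hA a) le_rfl
    _ = A * ∫⁻ x, Φ (h x) ∂P := by
        rw [lintegral_const_mul _ hΦ, lintegral_map hΦ hh]

/-- The process seen by one agent: inputs `z t`, noise `e t` of law `ν` that is independent of the
inputs up to time `t` and of the outputs before time `t`, and outputs
`y t = G (z t) (e t)`. -/
structure IsDriven {X Z 𝓔 Y : Type*} [MeasurableSpace X] [MeasurableSpace Z] [MeasurableSpace 𝓔]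
    [MeasurableSpace Y] (P : Measure X) (ν : Measure 𝓔) (G : Z → 𝓔 → Y) (T : ℕ)
    (z : ℕ → X → Z) (e : ℕ → X → 𝓔) (y : ℕ → X → Y) : Prop where
  measurable_input : ∀ t, Measurable (z t)
  measurable_noise : ∀ t, Measurable (e t)
  measurable_output : ∀ t, Measurable (y t)
  output_eq : ∀ t < T, ∀ᵐ x ∂P, y t x = G (z t x) (e t x)
  noise_law : ∀ t < T, P.map (e t) = ν
  noise_indep : ∀ t < T, IndepFun (e t)
    (fun x => ((fun u : Fin (t + 1) => z u x), fun u : Fin t => y u x)) P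

/-- A one-step bound that holds at every input multiplies along the trajectory. -/
theorem IsDriven.lintegral_prod_le_pow {X Z 𝓔 Y : Type*} [MeasurableSpace X] [MeasurableSpace Z]
    [MeasurableSpace 𝓔] [MeasurableSpace Y] {P : Measure X} [IsProbabilityMeasure P] {ν : Measure 𝓔}
    {G : Z → 𝓔 → Y} {T : ℕ} {z : ℕ → X → Z} {e : ℕ → X → 𝓔} {y : ℕ → X → Y}
    (hD : IsDriven P ν G T z e y) (hG : Measurable fun p : Z × 𝓔 => G p.1 p.2)
    {R : Z → Y → ℝ≥0∞} (hR : Measurable fun p : Z × Y => R p.1 p.2) {A : ℝ≥0∞}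
    (hA : ∀ a, ∫⁻ b, R a (G a b) ∂ν ≤ A) :
    ∫⁻ x, ∏ t ∈ Finset.range T, R (z t x) (y t x) ∂P ≤ A ^ T := by
  suffices ∀ t ≤ T, ∫⁻ x, ∏ u ∈ Finset.range t, R (z u x) (y u x) ∂P ≤ A ^ t from this T le_rfl
  intro t
  induction t with
  | zero => simp
  | succ t ih =>
    intro ht
    have htT : t < T := ht
    let Φ : (Fin (t + 1) → Z) × (Fin t → Y) → ℝ≥0∞ := fun p => ∏ u : Fin t, R (p.1 u.castSucc) (p.2 u)
    let g : ((Fin (t + 1) → Z) × (Fin t → Y)) × 𝓔 → ℝ≥0∞ := fun p =>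
      R (p.1.1 (Fin.last t)) (G (p.1.1 (Fin.last t)) p.2)
    have hΦ : Measurable Φ := Finset.measurable_fun_prod _ fun u _ =>
      have h1 : Measurable fun p : (Fin (t + 1) → Z) × (Fin t → Y) => p.1 u.castSucc :=
        (measurable_pi_apply _).comp measurable_fst
      have h2 : Measurable fun p : (Fin (t + 1) → Z) × (Fin t → Y) => p.2 u :=
        (measurable_pi_apply _).comp measurable_snd
      hR.comp (h1.prodMk h2)
    have hl : Measurable fun p : ((Fin (t + 1) → Z) × (Fin t → Y)) × 𝓔 => p.1.1 (Fin.last t) :=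
      (measurable_pi_apply _).comp (measurable_fst.comp measurable_fst)
    have hg : Measurable g := hR.comp (hl.prodMk (hG.comp (hl.prodMk measurable_snd)))
    have hh : Measurable fun x => ((fun u : Fin (t + 1) => z u x), fun u : Fin t => y u x) :=
      (measurable_pi_lambda _ fun u : Fin (t + 1) => hD.measurable_input u).prodMk
        (measurable_pi_lambda _ fun u : Fin t => hD.measurable_output u)
    have hstep := lintegral_mul_le_of_indepFun (hD.measurable_noise t) hh (hD.noise_indep t htT)
      hΦ hg (A := A) fun a => by rw [hD.noise_law t htT]; exact hA (a.1 (Fin.last t))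
    have hprod : ∀ x, Φ ((fun u : Fin (t + 1) => z u x), fun u : Fin t => y u x) =
        ∏ u ∈ Finset.range t, R (z u x) (y u x) := fun x =>
      Fin.prod_univ_eq_prod_range (fun u => R (z u x) (y u x)) t
    calc ∫⁻ x, ∏ u ∈ Finset.range (t + 1), R (z u x) (y u x) ∂P
        = ∫⁻ x, Φ ((fun u : Fin (t + 1) => z u x), fun u : Fin t => y u x) *
            g (((fun u : Fin (t + 1) => z u x), fun u : Fin t => y u x), e t x) ∂P := by
          refine lintegral_congr_ae ?_
          filter_upwards [hD.output_eq t htT] with x hx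
          rw [Finset.prod_range_succ, hprod, hx]
          rfl
      _ ≤ A * ∫⁻ x, ∏ u ∈ Finset.range t, R (z u x) (y u x) ∂P := by
          simpa only [hprod] using hstep
      _ ≤ A * A ^ t := mul_le_mul' le_rfl (ih htT.le)
      _ = A ^ (t + 1) := (pow_succ' A t).symm

section Agent

variable {k : ℕ} {Z E : Type*} [MeasurableSpace Z] [NormedAddCommGroup E]
  {Ω : Set E} {q : Fin k → ℝ → ℝ≥0} {F : Fin k → Z → E → ℝ → ℝ} {V L κ K : ℝ}

namespace RegularFamily

variable (H : RegularFamily Ω q F V L κ K)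
include H

theorem agentDensity_ne_top {w : E} (hw : w ∈ Ω) (z : Z) (y : Fin k → ℝ) :
    agentDensity q F w z y ≠ ∞ := by
  refine ENNReal.prod_ne_top fun j _ => ENNReal.div_ne_top ENNReal.coe_ne_top ?_
  simpa using H.κ_pos.trans_le (H.le_deriv j z w hw _)

theorem ae_agentDensity_ne_zero {w : E} (hw : w ∈ Ω) :
    ∀ᵐ e ∂(agentNoise q), ∀ z, agentDensity q F w z (fun j => F j z w (e j)) ≠ 0 := by
  have := H.isProb
  have h1 : ∀ j, ∀ᵐ e ∂(agentNoise q), (q j (e j) : ℝ≥0∞) ≠ 0 := by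
    intro j
    have h2 : ∀ᵐ x ∂(volume.withDensity fun e => (q j e : ℝ≥0∞)), (q j x : ℝ≥0∞) ≠ 0 := by
      rw [ae_withDensity_iff (H.measurable_noise_density j)]
      exact Filter.Eventually.of_forall fun x hx => hx
    exact (measurePreserving_eval (fun j => volume.withDensity fun e => (q j e : ℝ≥0∞))
      j).quasiMeasurePreserving.ae h2
  filter_upwards [ae_all_iff.2 h1] with e he z
  refine Finset.prod_ne_zero_iff.2 fun j _ => ?_
  rw [pushDensity, invFun_apply_of_le_deriv H.κ_pos (H.le_deriv j z w hw)]
  exact ENNReal.div_ne_zero.2 ⟨he j, ENNReal.ofReal_ne_top⟩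

theorem ae_trajectory_density_ne_zero {X : Type*} [MeasurableSpace X] {P : Measure X} {T : ℕ}
    {z : ℕ → X → Z} {e y : ℕ → X → Fin k → ℝ} {wstar : E} (hstar : wstar ∈ Ω)
    (hD : IsDriven P (agentNoise q) (fun z e j => F j z wstar (e j)) T z e y) :
    ∀ᵐ x ∂P, ∀ t ∈ Finset.range T, agentDensity q F wstar (z t x) (y t x) ≠ 0 := by
  refine ae_all_iff.2 fun t => ?_
  by_cases ht : t ∈ Finset.range T
  · have ht' := Finset.mem_range.1 ht
    have h1 := H.ae_agentDensity_ne_zero hstar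
    rw [← hD.noise_law t ht'] at h1
    filter_upwards [ae_of_ae_map (hD.measurable_noise t).aemeasurable h1,
      hD.output_eq t ht'] with x hx hy _
    rw [hy]
    exact hx _
  · exact Filter.Eventually.of_forall fun x h => absurd h ht

/-- If the likelihood of some factor at distance at most `η` from `w` is at least that of the true
factor `wstar` on an event `B`, then the square roots of the ratios between the bracket
about `w` and the true density have a product of at least `1` on `B`; the expectation of this product
bounds the probability of `B`. -/
theorem measure_le_of_near {X : Type*} [MeasurableSpace X] {P : Measure X} [IsProbabilityMeasure P]
    {T : ℕ} {z : ℕ → X → Z} {e y : ℕ → X → Fin k → ℝ} {w wstar : E} (hw : w ∈ Ω)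
    (hstar : wstar ∈ Ω)
    (hD : IsDriven P (agentNoise q) (fun z e j => F j z wstar (e j)) T z e y) {η γ τ : ℝ}
    (hη : 0 ≤ η) (hγ : 0 ≤ γ)
    (hmass : ((1 + K * (η + L * η / κ) / κ) * (1 + 2 * (L * η / κ) * V)) ^ k ≤ 1 + γ)
    (hτ : 0 < τ)
    (hsep : ∀ z, τ ≤ NetworkedMARL.tvDist ((agentNoise q).map fun e j => F j z wstar (e j))
      ((agentNoise q).map fun e j => F j z w (e j)))
    {B : Set X} (hB : MeasurableSet B)
    (hlik : ∀ᵐ x ∂P, x ∈ B → ∃ w' ∈ Ω, ‖w' - w‖ ≤ η ∧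
      ∏ t ∈ Finset.range T, agentDensity q F wstar (z t x) (y t x) ≤
        ∏ t ∈ Finset.range T, agentDensity q F w' (z t x) (y t x)) :
    P B ≤ ENNReal.ofReal (1 - τ ^ 2 / 16 + 2 * √γ) ^ T := by
  have hpm := H.measurable_agentDensity hstar
  have hum := H.measurable_upperBracket hη hw
  have hne := H.ae_trajectory_density_ne_zero hstar hD
  refine le_trans ?_ (hD.lintegral_prod_le_pow (H.measurable_next wstar hstar)
    (R := fun z y => (upperBracket q F L κ K η w z y / agentDensity q F wstar z y) ^ (1 / 2 : ℝ))
    ((hum.div hpm).pow_const _)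
    fun z => H.lintegral_sqrt_ratio_le hw hstar hη hγ hmass hτ z (hsep z))
  rw [← lintegral_indicator_one hB]
  refine lintegral_mono_ae ?_
  filter_upwards [hne, hlik] with x hx hl
  by_cases hxB : x ∈ B
  · rw [Set.indicator_of_mem hxB, Pi.one_apply, ENNReal.prod_rpow_of_nonneg (by norm_num)]
    obtain ⟨w', hw', hd, hle⟩ := hl hxB
    refine ENNReal.one_le_rpow ?_ (by norm_num)
    have hp0 : ∏ t ∈ Finset.range T, agentDensity q F wstar (z t x) (y t x) ≠ 0 :=
      Finset.prod_ne_zero_iff.2 hx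
    have hpt : ∏ t ∈ Finset.range T, agentDensity q F wstar (z t x) (y t x) ≠ ∞ :=
      ENNReal.prod_ne_top fun t _ => H.agentDensity_ne_top hstar _ _
    refine (ENNReal.mul_le_mul_iff_left hp0 hpt).1 ?_
    rw [one_mul, ← Finset.prod_mul_distrib]
    refine hle.trans (Finset.prod_le_prod' fun t ht => ?_)
    rw [ENNReal.div_mul_cancel (hx t ht) (H.agentDensity_ne_top hstar _ _)]
    exact H.agentDensity_le_upperBracket hw' hw hd _ _
  · rw [Set.indicator_of_notMem hxB]
    exact bot_le

end RegularFamily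

end Agent

/-! ### The union bound over a grid -/

theorem abs_sub_le_of_floor_div_eq {x y h : ℝ} (hh : 0 < h) (hx : 0 ≤ x) (hy : 0 ≤ y)
    (hxy : ⌊x / h⌋₊ = ⌊y / h⌋₊) : |x - y| ≤ h := by
  have h1 := Nat.floor_le (div_nonneg hx hh.le)
  have h2 := Nat.lt_floor_add_one (x / h)
  have h3 := Nat.floor_le (div_nonneg hy hh.le)
  have h4 := Nat.lt_floor_add_one (y / h)
  rw [hxy] at h1 h2
  have h5 : |x / h - y / h| ≤ 1 := abs_le.2 ⟨by linarith, by linarith⟩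
  rwa [← sub_div, abs_div, abs_of_pos hh, div_le_one hh] at h5

section Grid

variable {k d : ℕ} {Z : Type*} [MeasurableSpace Z] {Ω : Set (EuclideanSpace ℝ (Fin d))}
  {q : Fin k → ℝ → ℝ≥0} {F : Fin k → Z → EuclideanSpace ℝ (Fin d) → ℝ → ℝ} {V L κ K α : ℝ}

namespace RegularFamily

variable (H : RegularFamily Ω q F V L κ K)
include H

/-- The cubes of side `h` that meet `Ω` are at most `(2 R / h + 1) ^ d` in number and have diameter at
most `η`, so `measure_le_of_near` applies to each cube that contains a factor `w` of `Ω` at distance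
more than `r` from the truth. -/
theorem measure_far_le_of_grid {X : Type*} [MeasurableSpace X] {P : Measure X}
    [IsProbabilityMeasure P] {T : ℕ} {z : ℕ → X → Z} {e y : ℕ → X → Fin k → ℝ}
    {wstar : EuclideanSpace ℝ (Fin d)} (hstar : wstar ∈ Ω)
    (hD : IsDriven P (agentNoise q) (fun z e j => F j z wstar (e j)) T z e y) {η γ r h R : ℝ}
    (hη : 0 ≤ η) (hγ : 0 ≤ γ)
    (hmass : ((1 + K * (η + L * η / κ) / κ) * (1 + 2 * (L * η / κ) * V)) ^ k ≤ 1 + γ)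
    (hα : 0 < α) (hr : 0 < r) (hh : 0 < h) (hhη : d * h ^ 2 ≤ η ^ 2)
    (hR : ∀ w ∈ Ω, ‖w - wstar‖ ≤ R)
    (hsep : ∀ z, ∀ w ∈ Ω, ∀ w' ∈ Ω, ∀ r : ℝ, 0 < r → r ≤ ‖w - w'‖ →
      α * r ≤ NetworkedMARL.tvDist ((agentNoise q).map fun e j => F j z w (e j))
        ((agentNoise q).map fun e j => F j z w' (e j)))
    {what : X → EuclideanSpace ℝ (Fin d)} (hwm : Measurable what)
    (hmle : ∀ᵐ x ∂P, what x ∈ Ω ∧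
      ∏ t ∈ Finset.range T, agentDensity q F wstar (z t x) (y t x) ≤
        ∏ t ∈ Finset.range T, agentDensity q F (what x) (z t x) (y t x)) :
    P {x | r < ‖what x - wstar‖} ≤
      (⌊2 * R / h⌋₊ + 1 : ℕ) ^ d * ENNReal.ofReal (1 - (α * r) ^ 2 / 16 + 2 * √γ) ^ T := by
  set cell : EuclideanSpace ℝ (Fin d) → Fin d → ℕ := fun w l => ⌊(w l - wstar l + R) / h⌋₊ with hcell
  have hcoord : ∀ w ∈ Ω, ∀ l, |w l - wstar l| ≤ R := fun w hw l =>
    (PiLp.norm_apply_le (w - wstar) l).trans (hR w hw)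
  have hcellm : Measurable fun x => cell (what x) := measurable_pi_lambda _ fun l =>
    Nat.measurable_floor.comp (((((EuclideanSpace.proj (𝕜 := ℝ) l).continuous.measurable.comp
      hwm).sub_const _).add_const _).div_const _)
  have hfar : MeasurableSet {x | r < ‖what x - wstar‖} :=
    measurableSet_lt measurable_const (hwm.sub_const _).norm
  set idx : Finset (Fin d → ℕ) := Fintype.piFinset fun _ => Finset.range (⌊2 * R / h⌋₊ + 1)
  set B : (Fin d → ℕ) → Set X := fun c => {x | r < ‖what x - wstar‖} ∩ {x | cell (what x) = c}
    with hB
  have hcover : P {x | r < ‖what x - wstar‖} ≤ P (⋃ c ∈ idx, B c) := by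
    refine measure_mono_ae ?_
    filter_upwards [hmle] with x hx hxr
    refine Set.mem_iUnion₂.2 ⟨cell (what x), ?_, hxr, rfl⟩
    refine Fintype.mem_piFinset.2 fun l => Finset.mem_range.2 (Nat.lt_succ_of_le (Nat.floor_le_floor ?_))
    have := (abs_le.1 (hcoord _ hx.1 l)).2
    gcongr
    linarith
  have hcellB : ∀ c, P (B c) ≤ ENNReal.ofReal (1 - (α * r) ^ 2 / 16 + 2 * √γ) ^ T := by
    intro c
    by_cases hc : ∃ w ∈ Ω, r < ‖w - wstar‖ ∧ cell w = c
    · obtain ⟨w, hw, hwr, rfl⟩ := hc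
      refine H.measure_le_of_near hw hstar hD hη hγ hmass (mul_pos hα hr)
        (fun z => hsep z wstar hstar w hw r hr (by rw [norm_sub_rev]; exact hwr.le))
        (hfar.inter (hcellm (MeasurableSet.singleton _))) ?_
      filter_upwards [hmle] with x hx hxB
      refine ⟨what x, hx.1, ?_, hx.2⟩
      rw [EuclideanSpace.norm_eq]
      refine Real.sqrt_le_iff.2 ⟨hη, le_trans ?_ hhη⟩
      calc ∑ l, ‖(what x - w) l‖ ^ 2 ≤ ∑ _l : Fin d, h ^ 2 := by
            refine Finset.sum_le_sum fun l _ => ?_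
            have h1 := abs_le.1 (hcoord _ hx.1 l)
            have h2 := abs_le.1 (hcoord _ hw l)
            have h3 := abs_sub_le_of_floor_div_eq hh (show 0 ≤ what x l - wstar l + R by linarith)
              (show 0 ≤ w l - wstar l + R by linarith) (congrFun hxB.2 l)
            have h4 : ‖(what x - w) l‖ ≤ h := by
              rw [Real.norm_eq_abs, PiLp.sub_apply]
              convert h3 using 2
              ring
            gcongr
        _ = d * h ^ 2 := by simp
    · have : P (B c) = 0 := by
        refine measure_mono_null_ae ?_ (measure_empty (μ := P))
        filter_upwards [hmle] with x hx hxB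
        exact hc ⟨what x, hx.1, hxB.1, hxB.2⟩
      rw [this]
      exact bot_le
  calc P {x | r < ‖what x - wstar‖} ≤ ∑ c ∈ idx, P (B c) :=
        hcover.trans (measure_biUnion_finset_le _ _)
    _ ≤ ∑ _c ∈ idx, ENNReal.ofReal (1 - (α * r) ^ 2 / 16 + 2 * √γ) ^ T :=
        Finset.sum_le_sum fun c _ => hcellB c
    _ = _ := by
        rw [Finset.sum_const, nsmul_eq_mul]
        simp [idx]

end RegularFamily

end Grid

/-! ### The rate of one agent -/

/-- The growth rate, per unit of radius, of the mass of the upper bracket in one component. -/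
noncomputable def bracketRate (L V κ K : ℝ) : ℝ := K * (1 + L / κ) / κ + 2 * (L / κ) * V

/-- The number of grid cells per coordinate is at most this constant times `T ^ 3`. -/
noncomputable def gridConst (m : ℕ) (L V κ K α : ℝ) : ℝ := 16 * (m * bracketRate L V κ K + 1) / α + 1

/-- The constant in the rate of the estimator. Its square is chosen such that the exponent
`T α² r² / 16` outweighs the logarithm of the number of grid cells by `log (n / δ) + 1`. -/
noncomputable def rateConst (m : ℕ) (L V κ K α : ℝ) : ℝ :=
  4 * √(6 + 2 * Real.log (gridConst m L V κ K α)) / α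

section Constants

variable {m : ℕ} {L V κ K α : ℝ} (hL : 0 ≤ L) (hV : 0 ≤ V) (hκ : 0 < κ) (hK : 0 ≤ K) (hα : 0 < α)
include hL hV hκ hK

theorem bracketRate_nonneg : 0 ≤ bracketRate L V κ K := by unfold bracketRate; positivity

theorem bracket_mass_le {k : ℕ} (hk : k ≤ m) {η : ℝ} (hη : 0 ≤ η)
    (hη1 : m * bracketRate L V κ K * η ≤ 1) :
    ((1 + K * (η + L * η / κ) / κ) * (1 + 2 * (L * η / κ) * V)) ^ k ≤
      1 + 2 * (m * bracketRate L V κ K * η) := by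
  have hB := bracketRate_nonneg hL hV hκ hK
  have h1 : (1 + K * (η + L * η / κ) / κ) * (1 + 2 * (L * η / κ) * V) ≤
      Real.exp (bracketRate L V κ K * η) := by
    have : bracketRate L V κ K * η = K * (η + L * η / κ) / κ + 2 * (L * η / κ) * V := by
      unfold bracketRate; ring
    rw [this, Real.exp_add]
    have h2 := Real.add_one_le_exp (K * (η + L * η / κ) / κ)
    have h3 := Real.add_one_le_exp (2 * (L * η / κ) * V)
    exact mul_le_mul (by linarith) (by linarith) (by positivity) (Real.exp_pos _).le
  have hx0 : 0 ≤ m * bracketRate L V κ K * η := by positivity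
  calc _ ≤ Real.exp (bracketRate L V κ K * η) ^ k := pow_le_pow_left₀ (by positivity) h1 k
    _ ≤ Real.exp (bracketRate L V κ K * η) ^ m :=
        pow_le_pow_right₀ (Real.one_le_exp (by positivity)) hk
    _ = Real.exp (m * bracketRate L V κ K * η) := by rw [← Real.exp_nat_mul]; ring_nf
    _ ≤ _ := by
        have := (abs_le.1 (Real.abs_exp_sub_one_sub_id_le (x := m * bracketRate L V κ K * η)
          (by rw [abs_of_nonneg hx0]; exact hη1))).2
        nlinarith

include hα

theorem one_le_gridConst : 1 ≤ gridConst m L V κ K α := by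
  have hB := bracketRate_nonneg hL hV hκ hK
  have : 0 ≤ 16 * (m * bracketRate L V κ K + 1) / α := by positivity
  unfold gridConst; linarith

theorem rateConst_sq :
    (rateConst m L V κ K α * α) ^ 2 = 16 * (6 + 2 * Real.log (gridConst m L V κ K α)) := by
  have h := Real.log_nonneg (one_le_gridConst (m := m) hL hV hκ hK hα)
  rw [rateConst, div_mul_cancel₀ _ hα.ne', mul_pow, Real.sq_sqrt (by positivity)]
  norm_num

theorem rateConst_pos : 0 < rateConst m L V κ K α := by
  have h := Real.log_nonneg (one_le_gridConst (m := m) hL hV hκ hK hα)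
  unfold rateConst; positivity

end Constants

/-- The exponent of the union bound: `g` is the logarithm of `gridConst`, `l` that of `T`, `l'` that
of `n / δ` and `Λ` that of `n T / δ`. -/
theorem exponent_le {g d l l' Λ : ℝ} (hg : 0 ≤ g) (hd : 1 ≤ d) (hl : 0 ≤ l) (hl' : 0 ≤ l')
    (hΛ : Λ = l + l') (hΛ2 : 1 / 2 ≤ Λ) :
    d * (g + 3 * l) + (1 - (6 + 2 * g) * (d * Λ)) ≤ -l' := by
  have hd0 : 0 ≤ d := by linarith
  have h1 : 1 / 2 ≤ d * Λ := by nlinarith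
  have h2 : d * g ≤ 2 * g * (d * Λ) := by
    have := mul_le_mul_of_nonneg_left hΛ2 (mul_nonneg hd0 hg)
    linarith
  have h3 : d * l ≤ d * Λ := mul_le_mul_of_nonneg_left (by linarith) hd0
  have h4 : l' ≤ d * Λ := by
    have := mul_le_mul_of_nonneg_right hd (show 0 ≤ Λ by linarith)
    linarith
  linarith

section Rate

variable {k d m : ℕ} {Z : Type*} [MeasurableSpace Z] {Ω : Set (EuclideanSpace ℝ (Fin d))}
  {q : Fin k → ℝ → ℝ≥0} {F : Fin k → Z → EuclideanSpace ℝ (Fin d) → ℝ → ℝ} {V L κ K α : ℝ}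

/-- A likelihood maximiser of one agent is within the claimed distance of the truth, with
probability of failure at most `δ / n`. -/
theorem RegularFamily.measure_far_le (H : RegularFamily Ω q F V L κ K) (hk : k ≤ m)
    {X : Type*} [MeasurableSpace X] {P : Measure X}
    [IsProbabilityMeasure P] {T : ℕ} {z : ℕ → X → Z} {e y : ℕ → X → Fin k → ℝ}
    {wstar : EuclideanSpace ℝ (Fin d)} (hstar : wstar ∈ Ω)
    (hD : IsDriven P (agentNoise q) (fun z e j => F j z wstar (e j)) T z e y)
    (hα : 0 < α)
    (hsep : ∀ z, ∀ w ∈ Ω, ∀ w' ∈ Ω, ∀ r : ℝ, 0 < r → r ≤ ‖w - w'‖ →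
      α * r ≤ NetworkedMARL.tvDist ((agentNoise q).map fun e j => F j z w (e j))
        ((agentNoise q).map fun e j => F j z w' (e j)))
    {what : X → EuclideanSpace ℝ (Fin d)} (hwm : Measurable what)
    (hmle : ∀ᵐ x ∂P, what x ∈ Ω ∧
      ∏ t ∈ Finset.range T, agentDensity q F wstar (z t x) (y t x) ≤
        ∏ t ∈ Finset.range T, agentDensity q F (what x) (z t x) (y t x))
    {n : ℕ} {δ : ℝ} (hn : 2 ≤ n * T) (hδ : 0 < δ) (hδ1 : δ < 1) :
    P {x | rateConst m L V κ K α * √(d * Real.log (n * T / δ) / T) < ‖what x - wstar‖} ≤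
      ENNReal.ofReal (δ / n) := by
  have hL := H.L_nonneg
  have hV := H.V_nonneg
  have hκ := H.κ_pos
  have hK := H.K_nonneg
  have hC := rateConst_pos (m := m) hL hV hκ hK hα
  have hC2 := rateConst_sq (m := m) hL hV hκ hK hα
  have hG := one_le_gridConst (m := m) hL hV hκ hK hα
  have hG0 := Real.log_nonneg hG
  have hBr := bracketRate_nonneg hL hV hκ hK
  set C := rateConst m L V κ K α
  set Λ := Real.log (n * T / δ) with hΛ
  have hnpos : 0 < n := Nat.pos_of_ne_zero fun h => by simp [h] at hn
  have hTpos : 0 < T := Nat.pos_of_ne_zero fun h => by simp [h] at hn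
  have hT1 : (1 : ℝ) ≤ T := by exact_mod_cast hTpos
  have hn1 : (1 : ℝ) ≤ n := by exact_mod_cast hnpos
  have hT0 : (0 : ℝ) < T := by linarith
  have hnT : (2 : ℝ) ≤ n * T := by exact_mod_cast hn
  have hΛ2 : 1 / 2 ≤ Λ := by
    have h1 : Real.log 2 ≤ Λ := Real.log_le_log (by norm_num) (by
      rw [le_div_iff₀ hδ]; nlinarith)
    linarith [Real.log_two_gt_d9]
  have hsplit : Λ = Real.log T + Real.log (n / δ) := by
    rw [hΛ, ← Real.log_mul hT0.ne' (by positivity)]; congr 1; ring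
  have hlogT : 0 ≤ Real.log T := Real.log_nonneg hT1
  have hlogn : 0 ≤ Real.log (n / δ) := Real.log_nonneg (by rw [le_div_iff₀ hδ]; linarith)
  rcases Nat.eq_zero_or_pos d with rfl | hd
  · have : ∀ x, ‖what x - wstar‖ = 0 := fun x => by
      rw [Subsingleton.elim (what x) wstar, sub_self, norm_zero]
    simp [this]
  have hd1 : (1 : ℝ) ≤ d := by exact_mod_cast hd
  -- laws are at total variation distance at most one, so separation bounds the diameter of `Ω`
  have hR : ∀ w ∈ Ω, ‖w - wstar‖ ≤ 1 / α := by
    intro w hw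
    rcases (norm_nonneg (w - wstar)).eq_or_lt with h0 | h0
    · rw [← h0]; positivity
    have : Nonempty X := nonempty_of_isProbabilityMeasure P
    let z0 := z 0 (Classical.arbitrary X)
    have := H.isProbabilityMeasure_agentNoise
    have hm : ∀ w ∈ Ω, IsProbabilityMeasure ((agentNoise q).map fun e j => F j z0 w (e j)) :=
      fun w hw => Measure.isProbabilityMeasure_map
        ((H.measurable_next w hw).comp measurable_prodMk_left).aemeasurable
    have := hm w hw
    have := hm wstar hstar
    rw [le_div_iff₀ hα, mul_comm]
    exact (hsep z0 w hw wstar hstar _ h0 le_rfl).trans tvDist_le_one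
  rcases le_or_gt T d with hTd | hTd
  · -- the claimed bound exceeds the diameter of `Ω`
    have hTd' : (T : ℝ) ≤ d := by exact_mod_cast hTd
    have h1 : 1 / 2 ≤ d * Λ / T := by
      rw [le_div_iff₀ hT0]; nlinarith
    have h2 : 1 / α ≤ C * √(d * Λ / T) := by
      rw [div_le_iff₀ hα]
      have h3 : 1 ≤ (C * √(d * Λ / T) * α) ^ 2 := by
        have : (C * √(d * Λ / T) * α) ^ 2 = (C * α) ^ 2 * (d * Λ / T) := by
          rw [mul_right_comm, mul_pow, Real.sq_sqrt (by linarith)]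
        rw [this, hC2]
        nlinarith
      exact (one_le_sq_iff₀ (by positivity)).1 h3
    have : P {x | C * √(d * Λ / T) < ‖what x - wstar‖} = 0 := by
      refine measure_mono_null_ae ?_ (measure_empty (μ := P))
      filter_upwards [hmle] with x hx hxr
      exact absurd (lt_of_lt_of_le hxr ((hR _ hx.1).trans h2)) (lt_irrefl _)
    rw [this]
    exact bot_le
  · have hTd' : (d : ℝ) ≤ T := by exact_mod_cast hTd.le
    set b := m * bracketRate L V κ K with hb
    have hb0 : 0 ≤ b := by positivity
    have hb1 : 0 < b + 1 := by linarith
    -- the excess mass of the bracket of radius `η` costs a bounded factor over `T` steps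
    set η : ℝ := 1 / (8 * T ^ 2 * (b + 1)) with hη
    have hη0 : 0 < η := by positivity
    have hbη : b * η ≤ 1 / (8 * T ^ 2) := by
      rw [hη, mul_one_div, div_le_div_iff₀ (by positivity) (by positivity)]
      nlinarith [sq_nonneg (T : ℝ)]
    have hT2 : 1 / (8 * (T : ℝ) ^ 2) ≤ 1 / 8 :=
      one_div_le_one_div_of_le (by norm_num) (by nlinarith)
    have hmass := bracket_mass_le (m := m) hL hV hκ hK hk hη0.le (by linarith)
    have hγ : 1 + 2 * (m * bracketRate L V κ K * η) ≤ 1 + (1 / (2 * T)) ^ 2 := by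
      have : (1 / (2 * (T : ℝ))) ^ 2 = 2 * (1 / (8 * T ^ 2)) := by field_simp; norm_num
      rw [this, ← hb]; linarith
    have hr0 : 0 < d * Λ / T := by positivity
    have hr : 0 < C * √(d * Λ / T) := by positivity
    refine (H.measure_far_le_of_grid hstar hD hη0.le (sq_nonneg _) (hmass.trans hγ) hα hr
      (h := η / T) (by positivity) ?_ hR hsep hwm hmle).trans ?_
    · rw [div_pow, mul_div_assoc', div_le_iff₀ (by positivity), mul_comm]
      exact mul_le_mul_of_nonneg_left (by nlinarith) (sq_nonneg _)
    rw [Real.sqrt_sq (by positivity)]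
    have hcard : ((⌊2 * (1 / α) / (η / T)⌋₊ + 1 : ℕ) : ℝ) ≤ gridConst m L V κ K α * T ^ 3 := by
      push_cast
      have h1 := Nat.floor_le (show 0 ≤ 2 * (1 / α) / (η / T) by positivity)
      have h2 : 2 * (1 / α) / (η / T) = 16 * (b + 1) / α * T ^ 3 := by
        rw [hη]; field_simp; norm_num
      have h3 : (1 : ℝ) ≤ T ^ 3 := one_le_pow₀ hT1
      rw [gridConst, add_mul, one_mul]
      linarith
    have hstep : 1 - (α * (C * √(d * Λ / T))) ^ 2 / 16 + 2 * (1 / (2 * T)) ≤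
        Real.exp ((1 - (6 + 2 * Real.log (gridConst m L V κ K α)) * (d * Λ)) / T) := by
      refine le_trans (le_of_eq ?_) (Real.add_one_le_exp _)
      rw [← mul_assoc, mul_comm α C, mul_pow, Real.sq_sqrt hr0.le, hC2]
      field_simp
      ring
    have hGT : 0 < gridConst m L V κ K α * T ^ 3 := by positivity
    calc _ ≤ ENNReal.ofReal (gridConst m L V κ K α * T ^ 3) ^ d * ENNReal.ofReal (Real.exp
          ((1 - (6 + 2 * Real.log (gridConst m L V κ K α)) * (d * Λ)) / T)) ^ T := by
          gcongr
          rw [← ENNReal.ofReal_natCast]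
          exact ENNReal.ofReal_le_ofReal hcard
      _ = ENNReal.ofReal (Real.exp (d * (Real.log (gridConst m L V κ K α) + 3 * Real.log T) +
          (1 - (6 + 2 * Real.log (gridConst m L V κ K α)) * (d * Λ)))) := by
          rw [← ENNReal.ofReal_pow hGT.le, ← ENNReal.ofReal_pow (Real.exp_pos _).le,
            ← ENNReal.ofReal_mul (by positivity), Real.exp_add, ← Real.exp_nat_mul,
            mul_div_cancel₀ _ hT0.ne', Real.exp_nat_mul, Real.exp_add,
            Real.exp_log (by linarith), mul_comm (3 : ℝ), ← Real.rpow_def_of_pos hT0]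
          norm_cast
      _ ≤ ENNReal.ofReal (δ / n) := by
          refine ENNReal.ofReal_le_ofReal ?_
          rw [show δ / n = Real.exp (-Real.log (n / δ)) by
            rw [← Real.log_inv, inv_div, Real.exp_log (by positivity)], Real.exp_le_exp]
          exact exponent_le hG0 hd1 hlogT hlogn hsplit hΛ2

end Rate

/-! ### Joint and agentwise maximum likelihood -/

section Extended

theorem ereal_sum_ne_bot {ι : Type*} {s : Finset ι} {a : ι → EReal} (ha : ∀ i ∈ s, a i ≠ ⊥) :
    ∑ i ∈ s, a i ≠ ⊥ :=
  Finset.sum_induction a (· ≠ ⊥) (fun _ _ hx hy => EReal.add_ne_bot_iff.2 ⟨hx, hy⟩)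
    EReal.zero_ne_bot ha

theorem ereal_sum_ne_top {ι : Type*} {s : Finset ι} {a : ι → EReal} (ha : ∀ i ∈ s, a i ≠ ⊤) :
    ∑ i ∈ s, a i ≠ ⊤ :=
  Finset.sum_induction a (· ≠ ⊤) (fun _ _ hx hy => (EReal.add_lt_top hx hy).ne)
    EReal.zero_ne_top ha

/-- If replacing the `i`-th term of a sum by `b i` does not decrease it, then `a i ≤ b i`. The bound by
the sum of all `b i` excludes that the remaining terms are infinite, so they can be cancelled. -/
theorem ereal_le_of_sum_le_sum_update {ι : Type*} [Fintype ι] [DecidableEq ι] {a b : ι → EReal}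
    (ha : ∀ i, a i ≠ ⊥) (hb : ∀ i, b i ≠ ⊤) (hab : ∑ i, a i ≤ ∑ i, b i) (i : ι)
    (hi : ∑ j, a j ≤ ∑ j, Function.update a i (b i) j) : a i ≤ b i := by
  by_contra! hlt
  have htop : ∑ i, a i ≠ ⊤ := ne_top_of_le_ne_top (ereal_sum_ne_top fun i _ => hb i) hab
  rw [Finset.sum_update_of_mem (Finset.mem_univ i)] at hi
  rw [← Finset.add_sum_erase _ _ (Finset.mem_univ i), ← Finset.sdiff_singleton_eq_erase] at hi htop
  have hbot : ∑ j ∈ Finset.univ \ {i}, a j ≠ ⊥ := ereal_sum_ne_bot fun j _ => ha j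
  generalize ∑ j ∈ Finset.univ \ {i}, a j = S at *
  induction S with
  | bot => exact hbot rfl
  | top => exact htop (EReal.add_top_of_ne_bot (ha i))
  | coe S => exact absurd (EReal.add_lt_add_right_coe hlt S) (not_lt.2 hi)

theorem ennreal_log_prod {ι : Type*} (s : Finset ι) (f : ι → ℝ≥0∞) :
    ENNReal.log (∏ i ∈ s, f i) = ∑ i ∈ s, ENNReal.log (f i) := by
  classical
  induction s using Finset.induction_on with
  | empty => simp
  | insert i s hi ih => rw [Finset.prod_insert hi, Finset.sum_insert hi, ENNReal.log_mul_add, ih]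

end Extended

namespace NetworkedMARL.Model

variable {n : ℕ} {N : Network n} {M : Model N} {c : Masks N}

/-- The likelihood of the factor `w` of agent `i` on the first `T` transitions. -/
noncomputable def likelihood (M : Model N) (c : Masks N) (T : ℕ) (s : ℕ → N.State)
    (a : ℕ → N.Action) (i : Fin n) (w : N.LocalFactor i) : ℝ≥0∞ :=
  ∏ t ∈ Finset.range T, M.transitionDensity c i (N.restrict i (s t)) (a t i) w (s (t + 1) i)

theorem negLogLik_eq (T : ℕ) (s : ℕ → N.State) (a : ℕ → N.Action) (i : Fin n)
    (w : N.LocalFactor i) :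
    M.negLogLik c T s a i w = -(ENNReal.log (M.likelihood c T s a i w) / (T : EReal)) := by
  rw [negLogLik, likelihood, ennreal_log_prod]

/-- A joint minimiser of the average negative log-likelihood maximises the likelihood of every
agent. No sum cancels an infinity here: likelihoods are finite, and the sum at the estimate
is at most the finite sum at `wstar`. -/
theorem IsMLE.likelihood_le {T : ℕ} {s : ℕ → N.State} {a : ℕ → N.Action} {w wstar : N.Factor}
    (h : M.IsMLE c T s a w) (hT : 0 < T) (hstar : ∀ i, wstar i ∈ M.factorSpace i)
    (htop : ∀ i, M.likelihood c T s a i (w i) ≠ ∞)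
    (hzero : ∀ i, M.likelihood c T s a i (wstar i) ≠ 0) (i : Fin n) :
    M.likelihood c T s a i (wstar i) ≤ M.likelihood c T s a i (w i) := by
  have hT0 : (0 : EReal) < (T : EReal) := by exact_mod_cast hT
  have hTt : (T : EReal) ≠ ⊤ := EReal.natCast_ne_top T
  have hn0 : (0 : EReal) < (n : EReal) := by exact_mod_cast i.pos
  have hcancel : ∀ w' : N.Factor, (∀ i, w' i ∈ M.factorSpace i) →
      ∑ i, M.negLogLik c T s a i (w i) ≤ ∑ i, M.negLogLik c T s a i (w' i) := fun w' hw' =>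
    (EReal.strictMono_div_right_of_pos hn0 (EReal.natCast_ne_top n)).le_iff_le.1 (h.2 w' hw')
  have hle := ereal_le_of_sum_le_sum_update
    (a := fun i => M.negLogLik c T s a i (w i)) (b := fun i => M.negLogLik c T s a i (wstar i))
    (fun i => ?_) (fun i => ?_) (hcancel wstar hstar) i ?_
  · simp only [negLogLik_eq, EReal.neg_le_neg_iff] at hle
    exact ENNReal.log_le_log_iff.1 ((EReal.strictMono_div_right_of_pos hT0 hTt).le_iff_le.1 hle)
  · rw [negLogLik_eq, Ne, EReal.neg_eq_bot_iff]
    refine (lt_of_le_of_ne le_top fun heq => ?_).ne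
    have h1 : ENNReal.log (M.likelihood c T s a i (w i)) = ⊤ * (T : EReal) :=
      (EReal.div_eq_iff (EReal.natCast_ne_bot T) hTt hT0.ne').1 heq
    rw [EReal.top_mul_of_pos hT0, ENNReal.log_eq_top_iff] at h1
    exact htop i h1
  · rw [negLogLik_eq, Ne, EReal.neg_eq_top_iff]
    intro heq
    have h1 : ENNReal.log (M.likelihood c T s a i (wstar i)) = ⊥ * (T : EReal) :=
      (EReal.div_eq_iff (EReal.natCast_ne_bot T) hTt hT0.ne').1 heq
    rw [EReal.bot_mul_of_pos hT0, ENNReal.log_eq_bot_iff] at h1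
    exact hzero i h1
  · refine (hcancel (Function.update w i (wstar i)) fun j => ?_).trans
      (Finset.sum_le_sum fun j _ => ?_)
    · by_cases hj : j = i
      · subst hj; simpa using hstar j
      · simpa [hj] using h.1 j
    · by_cases hj : j = i
      · subst hj; simp
      · simp [hj]

/-! ### From the network to one agent -/

/-- The pairs of neighbouring states and own action that are admissible for agent `i`. -/
def admissible (M : Model N) (i : Fin n) : Set (N.NbrState i × N.LocalAction i) :=
  {p | (∀ k, p.1 k ∈ M.stateSpace k.1) ∧ p.2 ∈ M.actionSpace i}

/-- The transition maps of agent `i` over the admissible inputs. -/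
def agentMap (M : Model N) (c : Masks N) (i : Fin n) (j : Fin (N.stateDim i)) (z : M.admissible i)
    (w : N.LocalFactor i) (e : ℝ) : ℝ :=
  M.step c i j z.1.1 z.1.2 w e

theorem measurableSet_admissible (hS : ∀ i, MeasurableSet (M.stateSpace i))
    (hA : ∀ i, MeasurableSet (M.actionSpace i)) (i : Fin n) : MeasurableSet (M.admissible i) := by
  have h1 : MeasurableSet {p : N.NbrState i × N.LocalAction i | ∀ k, p.1 k ∈ M.stateSpace k.1} := by
    rw [Set.ofPred_forall]
    exact MeasurableSet.iInter fun k => ((measurable_pi_apply k).comp measurable_fst) (hS k.1)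
  exact h1.inter (measurable_snd (hA i))

theorem regularFamily {σ : ℝ≥0} {L V κ K : ℝ} (hL : 0 ≤ L) (hV : 0 ≤ V) (hκ : 0 < κ) (hK : 0 ≤ K)
    (hnoise : M.NoiseRegular σ V) (hdyn : M.DynamicsRegular c L κ K) (i : Fin n) :
    RegularFamily (M.factorSpace i) (M.noiseDensity i) (M.agentMap c i) V L κ K where
  L_nonneg := hL
  V_nonneg := hV
  K_nonneg := hK
  κ_pos := hκ
  isProb := hnoise.isProb i
  variation_le := hnoise.variation_le i
  measurable_map := fun j w hw => (hdyn.measurable_step i j w hw).comp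
    ((measurable_fst.comp (measurable_subtype_coe.comp measurable_fst)).prodMk
      ((measurable_snd.comp (measurable_subtype_coe.comp measurable_fst)).prodMk measurable_snd))
  lipschitz_factor := fun j z => hdyn.lipschitz_factor i j z.1.1 z.2.1 z.1.2 z.2.2
  le_deriv := fun j z => hdyn.le_deriv i j z.1.1 z.2.1 z.1.2 z.2.2
  lipschitz_deriv := fun j z => hdyn.lipschitz_deriv i j z.1.1 z.2.1 z.1.2 z.2.2

section Trajectory

variable {X : Type*} [MeasurableSpace X] {P : Measure X} {T : ℕ}
  {w : N.Factor} {s : ℕ → X → N.State} {a : ℕ → X → N.Action} {ε : ℕ → X → N.Noise}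

theorem IsTrajectory.ae_mem_admissible (h : M.IsTrajectory c P T w s a ε) (i : Fin n) {t : ℕ}
    (ht : t < T) : ∀ᵐ x ∂P, (N.restrict i (s t x), a t x i) ∈ M.admissible i := by
  filter_upwards [h.state_mem t ht, h.action_mem t ht] with x hs ha
  exact ⟨fun k => hs k.1, ha i⟩

/-- Inputs outside the admissible set occur with probability zero, so a measurable retraction
`π` onto this set turns the trajectory into a process of admissible inputs. -/
theorem IsTrajectory.isDriven (h : M.IsTrajectory c P T w s a ε)
    (hprob : ∀ i j, IsProbabilityMeasure (M.noiseLaw i j)) (i : Fin n)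
    {π : N.NbrState i × N.LocalAction i → M.admissible i} (hπ : Measurable π)
    (hπ' : ∀ z : M.admissible i, π z = z) :
    IsDriven P (agentNoise (M.noiseDensity i)) (fun z e j => M.agentMap c i j z (w i) (e j)) T
      (fun t x => π (N.restrict i (s t x), a t x i)) (fun t x => ε t x i)
      (fun t x => s (t + 1) x i) := by
  have hinput : Measurable fun p : N.State × N.Action => π (N.restrict i p.1, p.2 i) :=
    hπ.comp ((measurable_pi_lambda _ fun k => (measurable_pi_apply k.1).comp measurable_fst).prodMk
      ((measurable_pi_apply i).comp measurable_snd))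
  refine ⟨fun t => hinput.comp ((h.measurable_state t).prodMk (h.measurable_action t)),
    fun t => (measurable_pi_apply i).comp (h.measurable_noise t),
    fun t => (measurable_pi_apply i).comp (h.measurable_state (t + 1)), fun t ht => ?_,
    fun t ht => ?_, fun t ht => ?_⟩
  · filter_upwards [h.transition t ht, h.ae_mem_admissible i ht] with x hx hz
    have := hπ' ⟨_, hz⟩
    simp only at this
    rw [this]
    exact funext fun j => hx i j
  · have h1 : P.map (fun x => ε t x i) = (P.map (ε t)).map (Function.eval i) :=
      (Measure.map_map (measurable_pi_apply i) (h.measurable_noise t)).symm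
    rw [h1, h.noise_law t ht]
    exact (measurePreserving_eval (fun i => Measure.pi (M.noiseLaw i)) i).map_eq
  · let ψ : (Fin (t + 1) → N.State × N.Action) →
        (Fin (t + 1) → M.admissible i) × (Fin t → N.LocalState i) := fun h =>
      (fun u => π (N.restrict i (h u).1, (h u).2 i), fun u => (h u.succ).1 i)
    have hψ : Measurable ψ :=
      (measurable_pi_lambda _ fun u => hinput.comp (measurable_pi_apply u)).prodMk
        (measurable_pi_lambda _ fun u => (measurable_pi_apply i).comp
          (measurable_fst.comp (measurable_pi_apply u.succ)))
    exact (h.noise_indep t ht).comp (φ := fun e : N.Noise => e i) (measurable_pi_apply i) hψ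

/-- The estimate of each agent is within the claimed distance of the truth, with probability of
failure at most `δ / n`. -/
theorem IsTrajectory.measure_far_le [IsProbabilityMeasure P] {m : ℕ} {σ : ℝ≥0} {L V κ K α : ℝ}
    (hL : 0 ≤ L) (hV : 0 ≤ V) (hκ : 0 < κ) (hK : 0 ≤ K) (hα : 0 < α)
    (hm : ∀ i, N.stateDim i ≤ m)
    (hS : ∀ i, MeasurableSet (M.stateSpace i)) (hA : ∀ i, MeasurableSet (M.actionSpace i))
    (hnoise : M.NoiseRegular σ V) (hdyn : M.DynamicsRegular c L κ K) (hsep : M.Separated c α)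
    {δ : ℝ} (hnT : 2 ≤ n * T) (hδ : 0 < δ) (hδ1 : δ < 1) (hw : ∀ i, w i ∈ M.factorSpace i)
    (h : M.IsTrajectory c P T w s a ε) {what : X → N.Factor} (hwm : Measurable what)
    (hmle : ∀ᵐ x ∂P, M.IsMLE c T (fun t => s t x) (fun t => a t x) (what x)) (i : Fin n) :
    P {x | rateConst m L V κ K α * √(N.factorDim i * Real.log (n * T / δ) / T) <
      ‖what x i - w i‖} ≤ ENNReal.ofReal (δ / n) := by
  have hT : 0 < T := Nat.pos_of_ne_zero fun h => by simp [h] at hnT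
  have hret : ∀ i, ∃ π : N.NbrState i × N.LocalAction i → M.admissible i, Measurable π ∧
      ∀ z : M.admissible i, π z = z := by
    intro i
    obtain ⟨x, hx⟩ := (h.ae_mem_admissible i hT).exists
    obtain ⟨π, hπ, hπ'⟩ := (MeasurableEmbedding.subtype_coe
      (measurableSet_admissible hS hA i)).exists_measurable_extend measurable_id fun _ => ⟨⟨_, hx⟩⟩
    exact ⟨π, hπ, fun z => congrFun hπ' z⟩
  choose π hπ hπ' using hret
  have hreg := regularFamily (c := c) hL hV hκ hK hnoise hdyn
  have hD := fun i => h.isDriven hnoise.isProb i (hπ i) (hπ' i)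
  have hadm : ∀ᵐ x ∂P, ∀ i, ∀ t ∈ Finset.range T,
      (N.restrict i (s t x), a t x i) ∈ M.admissible i := by
    refine ae_all_iff.2 fun i => ae_all_iff.2 fun t => ?_
    by_cases ht : t ∈ Finset.range T
    · filter_upwards [h.ae_mem_admissible i (Finset.mem_range.1 ht)] with x hx _ using hx
    · exact Filter.Eventually.of_forall fun x hx => absurd hx ht
  have hlik : ∀ᵐ x ∂P, ∀ i v, M.likelihood c T (fun t => s t x) (fun t => a t x) i v =
      ∏ t ∈ Finset.range T, agentDensity (M.noiseDensity i) (M.agentMap c i) v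
        (π i (N.restrict i (s t x), a t x i)) (s (t + 1) x i) := by
    filter_upwards [hadm] with x hx i v
    refine Finset.prod_congr rfl fun t ht => ?_
    have := hπ' i ⟨_, hx i t ht⟩
    simp only at this
    rw [this]
    rfl
  refine (hreg i).measure_far_le (hm i) (hw i) (hD i) hα
    (fun z v hv v' hv' r => hsep i z.1.1 z.2.1 z.1.2 z.2.2 v hv v' hv' r)
    ((measurable_pi_apply i).comp hwm) ?_ hnT hδ hδ1
  filter_upwards [hmle, hlik,
    ae_all_iff.2 fun i => (hreg i).ae_trajectory_density_ne_zero (hw i) (hD i)] with x hx hl hne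
  refine ⟨hx.1 i, ?_⟩
  have := hx.likelihood_le hT hw
    (fun i => by
      rw [hl]; exact ENNReal.prod_ne_top fun t _ => (hreg i).agentDensity_ne_top (hx.1 i) _ _)
    (fun i => by rw [hl]; exact Finset.prod_ne_zero_iff.2 (hne i)) i
  rwa [hl, hl] at this

end Trajectory

end NetworkedMARL.Model

/-! ### The four bounds -/

theorem sqrt_sum_sq_le {ι : Type*} [Fintype ι] {v : ι → ℝ} {d : ι → ℕ} {C x : ℝ}
    (hC : 0 ≤ C) (hx : 0 ≤ x) (hv0 : ∀ i, 0 ≤ v i) (hv : ∀ i, v i ≤ C * √(d i * x)) :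
    √(∑ i, v i ^ 2) ≤ C * √((∑ i, d i : ℕ) * x) := by
  refine Real.sqrt_le_iff.2 ⟨by positivity, ?_⟩
  calc ∑ i, v i ^ 2 ≤ ∑ i, (C * √(d i * x)) ^ 2 :=
        Finset.sum_le_sum fun i _ => pow_le_pow_left₀ (hv0 i) (hv i) 2
    _ = ∑ i, C ^ 2 * (d i * x) := Finset.sum_congr rfl fun i _ => by
        rw [mul_pow, Real.sq_sqrt (by positivity)]
    _ = (C * √((∑ i, d i : ℕ) * x)) ^ 2 := by
        rw [mul_pow, Real.sq_sqrt (by positivity), ← Finset.mul_sum, ← Finset.sum_mul]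
        push_cast
        rfl

theorem mul_sqrt_le_of_le {C x a b d D : ℝ} (hC : 0 ≤ C) (hD : 0 < D) (hd : 0 ≤ d) (hx : 0 ≤ x)
    (hab : a ≤ b * d) : C * √(a * x) ≤ (C * √d / √D + 1) * √(b * D * x) := by
  have h1 : √(a * x) ≤ √d / √D * √(b * D * x) := by
    rw [← Real.sqrt_div hd, ← Real.sqrt_mul (by positivity)]
    refine Real.sqrt_le_sqrt ?_
    have : d / D * (b * D * x) = b * d * x := by field_simp
    rw [this]
    gcongr
  calc C * √(a * x) ≤ C * (√d / √D * √(b * D * x)) := by gcongr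
    _ = C * √d / √D * √(b * D * x) := by ring
    _ ≤ _ := by gcongr; linarith

theorem mainTheorem3 (m : ℕ) (σ : ℝ≥0) (L V κ K α : ℝ) (hL : 0 ≤ L) (hV : 0 ≤ V)
    (hκ : 0 < κ) (hK : 0 ≤ K) (hα : 0 < α) :
    ∃ C : ℝ, 0 < C ∧ ∀ (d : ℕ) (D : ℝ), ∃ C' : ℝ, 0 < C' ∧
      ∀ (n : ℕ) (N : NetworkedMARL.Network n) (M : NetworkedMARL.Model N)
        (c chat : NetworkedMARL.Masks N),
        (∀ i, N.stateDim i ≤ m) → (∀ i, N.factorDim i ≤ d) →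
        (∀ i, MeasurableSet (M.stateSpace i)) → (∀ i, MeasurableSet (M.actionSpace i)) →
        (∀ i, IsCompact (M.factorSpace i)) → (∀ i, Metric.diam (M.factorSpace i) ≤ D) →
        chat = c → M.NoiseRegular σ V → M.DynamicsRegular c L κ K → M.Separated c α →
      ∀ (T : ℕ) (δ : ℝ), 2 ≤ n * T → 0 < δ → δ < 1 →
      ∀ ωstar : N.Factor, (∀ i, ωstar i ∈ M.factorSpace i) →
      ∀ (X : Type*) [MeasurableSpace X] (P : Measure X) [IsProbabilityMeasure P]
        (s : ℕ → X → N.State) (a : ℕ → X → N.Action) (ε : ℕ → X → N.Noise),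
        M.IsTrajectory c P T ωstar s a ε →
      ∀ ωhat : X → N.Factor, Measurable ωhat →
        (∀ᵐ x ∂P, M.IsMLE chat T (fun t => s t x) (fun t => a t x) (ωhat x)) →
        ENNReal.ofReal (1 - δ) ≤ P {x |
          (∀ i, ‖ωhat x i - ωstar i‖ ≤
            C * Real.sqrt (N.factorDim i * Real.log (n * T / δ) / T)) ∧
          Real.sqrt (∑ i, ‖ωhat x i - ωstar i‖ ^ 2) ≤
            C * Real.sqrt ((∑ i, N.factorDim i : ℕ) * Real.log (n * T / δ) / T) ∧
          (∀ i, ‖ωhat x i - ωstar i‖ ≤ C' * Real.sqrt (D * Real.log (n * T / δ) / T)) ∧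
          Real.sqrt (∑ i, ‖ωhat x i - ωstar i‖ ^ 2) ≤
            C' * Real.sqrt (n * D * Real.log (n * T / δ) / T)} := by
  refine ⟨rateConst m L V κ K α, rateConst_pos hL hV hκ hK hα, fun d D =>
    ⟨rateConst m L V κ K α * √d / √D + 1, by
      have := rateConst_pos (m := m) hL hV hκ hK hα
      positivity, ?_⟩⟩
  intro n N M c chat hm hd hS hA hΩ hdiam hchat hnoise hdyn hsep T δ hnT hδ hδ1 ωstar hstar X _ P _
    s a ε htraj ωhat hωm hmle
  subst hchat
  have hC := (rateConst_pos (m := m) hL hV hκ hK hα).le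
  set C := rateConst m L V κ K α
  have hn0 : n ≠ 0 := fun h => by simp [h] at hnT
  have hT0 : T ≠ 0 := fun h => by simp [h] at hnT
  have hnT' : (2 : ℝ) ≤ n * T := by exact_mod_cast hnT
  set x := Real.log (n * T / δ) / T
  have hx0 : 0 ≤ x := div_nonneg (Real.log_nonneg (by rw [le_div_iff₀ hδ]; linarith)) (by positivity)
  have hassoc : ∀ c : ℝ, c * Real.log (n * T / δ) / T = c * x := fun c => mul_div_assoc _ _ _
  simp only [hassoc]
  have hbad := fun i => htraj.measure_far_le hL hV hκ hK hα hm hS hA hnoise hdyn hsep hnT hδ hδ1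
    hstar hωm hmle i
  simp only [hassoc] at hbad
  set bad : Set X := ⋃ i, {y | C * √(N.factorDim i * x) < ‖ωhat y i - ωstar i‖}
  have hbad' : P bad ≤ ENNReal.ofReal δ := by
    calc P bad ≤ ∑ i, P {y | C * √(N.factorDim i * x) < ‖ωhat y i - ωstar i‖} :=
          measure_iUnion_fintype_le _ _
      _ ≤ ∑ _i : Fin n, ENNReal.ofReal (δ / n) := Finset.sum_le_sum fun i _ => hbad i
      _ = ENNReal.ofReal δ := by
          rw [Finset.sum_const, Finset.card_univ, Fintype.card_fin, ← ENNReal.ofReal_nsmul,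
            nsmul_eq_mul, mul_div_cancel₀ _ (by exact_mod_cast hn0)]
  rw [ENNReal.ofReal_sub _ hδ.le, ENNReal.ofReal_one, tsub_le_iff_right, ← measure_univ (μ := P)]
  refine le_trans ?_ (add_le_add_right hbad' _)
  refine le_trans (measure_mono_ae ?_) (measure_union_le _ _)
  -- almost every point lies in `bad` or satisfies all four bounds
  filter_upwards [hmle] with y hy _
  by_cases hyb : y ∈ bad
  · exact Or.inr hyb
  left
  have hbound : ∀ i, ‖ωhat y i - ωstar i‖ ≤ C * √(N.factorDim i * x) := fun i =>
    not_lt.1 fun h => hyb (Set.mem_iUnion.2 ⟨i, h⟩)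
  have hsum := sqrt_sum_sq_le hC hx0 (fun i => norm_nonneg (ωhat y i - ωstar i)) hbound
  refine ⟨hbound, hsum, ?_⟩
  -- for `D ≤ 0` the quotient by `√D` in `C'` is a junk value, but then `Ω_i` has only one point
  rcases le_or_gt D 0 with hD | hD
  · have hzero : ∀ i, ‖ωhat y i - ωstar i‖ = 0 := fun i => le_antisymm
      (by
        rw [← dist_eq_norm]
        exact ((Metric.dist_le_diam_of_mem (hΩ i).isBounded (hy.1 i) (hstar i)).trans
          (hdiam i)).trans hD) (norm_nonneg _)
    simp only [hzero]
    exact ⟨fun i => by positivity, by simp; positivity⟩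
  · refine ⟨fun i => (hbound i).trans ?_, hsum.trans ?_⟩
    · have := mul_sqrt_le_of_le (a := N.factorDim i) (b := 1) hC hD (Nat.cast_nonneg d) hx0
        (by rw [one_mul]; exact_mod_cast hd i)
      rwa [one_mul] at this
    · refine mul_sqrt_le_of_le hC hD (Nat.cast_nonneg d) hx0 ?_
      have : ∑ i, N.factorDim i ≤ n * d := by
        simpa using Finset.sum_le_card_nsmul Finset.univ _ d fun i _ => hd i
      exact_mod_cast this
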